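/- **Theorem 4.6.** Let $H$ be a Hopf algebra over a field $k$ with comultiplication $\Delta$, counit $\varepsilon$ and bijective antipode. A *right coideal subalgebra* of $H$ is a subalgebra $A\subseteq H$ with $\Delta(A)\subseteq A\otimes_k H$; it is a *dominion subalgebra* if $A=\{h\in H : h\otimes 1=1\otimes h \text{ in } H\otimes_A H\}$. A *left $H$-module factor coalgebra* of $H$ is a quotient $C=H/I$ where $I$ is both a left ideal and a coideal of $H$; let $\pi:H\to C$ be the canonical map, by means of which $H$-comodules are regarded as $C$-comodules. For a subalgebra $A$ put $A^+=A\cap\operatorname{Ker}\varepsilon$, and for a left $H$-module factor coalgebra $C$ put ${}^{\mathrm{co}\,C}H=\{h\in H : (\pi\otimes\mathrm{id})\Delta(h)=\pi(1)\otimes h\}$. Then the assignments $A\mapsto H/HA^+$ and $C\mapsto {}^{\mathrm{co}\,C}H$ (Takeuchi's correspondence) are mutually inverse bijections between - the set of right coideal dominion subalgebras $A$ of $H$ such that $H$ is flat as a left $A$-module, and - the set of left $H$-module factor coalgebras $C$ of $H$ such that each finite-dimensional left $C$-comodule embeds as a $C$-subcomodule in some left $H$-comodule. Likewise, the same assignments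 are mutually inverse bijections between the set of right coideal dominion subalgebras $A$ of $H$ such that $H$ is flat as a right $A$-module and the set of left $H$-module factor coalgebras $C$ of $H$ such that each finite-dimensional right $C$-comodule embeds as a $C$-subcomodule in some right $H$-comodule. -/

import Mathlib

open scoped TensorProduct

namespace Takeuchi

universe u v

/-! ### Tensor products over a noncommutative algebra, and flatness

Right `A`-modules are modules over `Aᵐᵒᵖ`, so `MulOpposite.op a • m` is the product `m a`.
Every module over a `k`-algebra `A` is canonically a `k`-module; this structure is recorded by
`[Module k M] [IsScalarTower k A M]`. -/

section Balanced

variable (k : Type*) (A M N : Type*) [CommRing k] [Ring A] [Algebra k A]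
  [AddCommGroup M] [Module k M] [Module Aᵐᵒᵖ M]
  [AddCommGroup N] [Module k N] [Module A N]

/-- The subspace of `M ⊗ₖ N` spanned by all `m a ⊗ n - m ⊗ a n`. -/
def balancedRel : Submodule k (M ⊗[k] N) :=
  Submodule.span k {t | ∃ (m : M) (a : A) (n : N),
    t = (MulOpposite.op a • m) ⊗ₜ[k] n - m ⊗ₜ[k] (a • n)}

/-- The tensor product `M ⊗_A N` of a right `A`-module `M` and a left `A`-module `N`. -/
abbrev BalancedTensor : Type _ := (M ⊗[k] N) ⧸ balancedRel k A M N

variable {M N} in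
/-- The pure tensor `m ⊗ n` in `M ⊗_A N`. -/
def balancedTmul (m : M) (n : N) : BalancedTensor k A M N :=
  (balancedRel k A M N).mkQ (m ⊗ₜ[k] n)

end Balanced

section Functoriality

variable {k : Type*} {A : Type*} [CommRing k] [Ring A] [Algebra k A]

/-- The map `f ⊗ id : M ⊗_A N → M' ⊗_A N` induced by a map `f : M → M'` of right `A`-modules. -/
def balancedRTensor {M M' : Type*}
    [AddCommGroup M] [Module k M] [Module Aᵐᵒᵖ M] [IsScalarTower k Aᵐᵒᵖ M]
    [AddCommGroup M'] [Module k M'] [Module Aᵐᵒᵖ M'] [IsScalarTower k Aᵐᵒᵖ M']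
    (N : Type*) [AddCommGroup N] [Module k N] [Module A N]
    (f : M →ₗ[Aᵐᵒᵖ] M') : BalancedTensor k A M N →ₗ[k] BalancedTensor k A M' N :=
  Submodule.mapQ _ _ ((f.restrictScalars k).rTensor N) (by
    rw [balancedRel, Submodule.span_le]
    rintro _ ⟨m, a, n, rfl⟩
    refine Submodule.subset_span ⟨f m, a, n, ?_⟩
    simp)

/-- The map `id ⊗ f : M ⊗_A N → M ⊗_A N'` induced by a map `f : N → N'` of left `A`-modules. -/
def balancedLTensor (M : Type*) [AddCommGroup M] [Module k M] [Module Aᵐᵒᵖ M]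
    {N N' : Type*}
    [AddCommGroup N] [Module k N] [Module A N] [IsScalarTower k A N]
    [AddCommGroup N'] [Module k N'] [Module A N'] [IsScalarTower k A N']
    (f : N →ₗ[A] N') : BalancedTensor k A M N →ₗ[k] BalancedTensor k A M N' :=
  Submodule.mapQ _ _ ((f.restrictScalars k).lTensor M) (by
    rw [balancedRel, Submodule.span_le]
    rintro _ ⟨m, a, n, rfl⟩
    refine Submodule.subset_span ⟨m, a, f n, ?_⟩
    simp)

end Functoriality

section Flat

variable (k : Type u) (A : Type v) [CommRing k] [Ring A] [Algebra k A]

/-- A left `A`-module `N` is flat: the functor `? ⊗_A N` preserves injectivity of maps of right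
`A`-modules. -/
def IsLeftFlat (N : Type v) [AddCommGroup N] [Module k N] [Module A N] : Prop :=
  ∀ (M M' : Type (max u v))
    [AddCommGroup M] [Module k M] [Module Aᵐᵒᵖ M] [IsScalarTower k Aᵐᵒᵖ M]
    [AddCommGroup M'] [Module k M'] [Module Aᵐᵒᵖ M'] [IsScalarTower k Aᵐᵒᵖ M']
    (f : M →ₗ[Aᵐᵒᵖ] M'), Function.Injective f →
      Function.Injective (balancedRTensor (k := k) N f)

/-- A right `A`-module `M` is flat: the functor `M ⊗_A ?` preserves injectivity of maps of left
`A`-modules. -/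
def IsRightFlat (M : Type v) [AddCommGroup M] [Module k M] [Module Aᵐᵒᵖ M] : Prop :=
  ∀ (N N' : Type (max u v))
    [AddCommGroup N] [Module k N] [Module A N] [IsScalarTower k A N]
    [AddCommGroup N'] [Module k N'] [Module A N'] [IsScalarTower k A N']
    (f : N →ₗ[A] N'), Function.Injective f →
      Function.Injective (balancedLTensor (k := k) M f)

end Flat

/-! ### Comodules -/

section Comodule

variable {k : Type u} {C V : Type*} [Field k] [AddCommGroup C] [Module k C] [Coalgebra k C]
  [AddCommGroup V] [Module k V]

/-- `ρ : V → C ⊗ V` makes `V` a left `C`-comodule. -/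
structure IsLeftCoaction (ρ : V →ₗ[k] C ⊗[k] V) : Prop where
  coassoc : (TensorProduct.assoc k C C V).toLinearMap ∘ₗ
    (Coalgebra.comul (R := k) (A := C)).rTensor V ∘ₗ ρ = ρ.lTensor C ∘ₗ ρ
  counit : (Coalgebra.counit (R := k) (A := C)).rTensor V ∘ₗ ρ = TensorProduct.mk k k V 1

/-- `ρ : V → V ⊗ C` makes `V` a right `C`-comodule. -/
structure IsRightCoaction (ρ : V →ₗ[k] V ⊗[k] C) : Prop where
  coassoc : (TensorProduct.assoc k V C C).toLinearMap ∘ₗ ρ.rTensor C ∘ₗ ρ =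
    (Coalgebra.comul (R := k) (A := C)).lTensor V ∘ₗ ρ
  counit : (Coalgebra.counit (R := k) (A := C)).lTensor V ∘ₗ ρ = (TensorProduct.mk k V k).flip 1

end Comodule

section Extension

variable {k : Type u} {D C : Type v} [Field k] [AddCommGroup D] [Module k D] [Coalgebra k D]
  [AddCommGroup C] [Module k C] [Coalgebra k C]

/-- Every finite-dimensional left `C`-comodule embeds, as a `C`-subcomodule, in a left
`D`-comodule `W`, regarded as a `C`-comodule by means of `π : D → C`. -/
def LeftComodulesEmbed (π : D →ₗc[k] C) : Prop :=
  ∀ (V : Type (max u v)) [AddCommGroup V] [Module k V] [FiniteDimensional k V]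
    (ρ : V →ₗ[k] C ⊗[k] V), IsLeftCoaction ρ →
    ∃ (W : Type (max u v)) (_ : AddCommGroup W) (_ : Module k W) (σ : W →ₗ[k] D ⊗[k] W)
      (j : V →ₗ[k] W), IsLeftCoaction σ ∧ Function.Injective j ∧
        π.toLinearMap.rTensor W ∘ₗ σ ∘ₗ j = j.lTensor C ∘ₗ ρ

/-- Every finite-dimensional right `C`-comodule embeds, as a `C`-subcomodule, in a right
`D`-comodule `W`, regarded as a `C`-comodule by means of `π : D → C`. -/
def RightComodulesEmbed (π : D →ₗc[k] C) : Prop :=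
  ∀ (V : Type (max u v)) [AddCommGroup V] [Module k V] [FiniteDimensional k V]
    (ρ : V →ₗ[k] V ⊗[k] C), IsRightCoaction ρ →
    ∃ (W : Type (max u v)) (_ : AddCommGroup W) (_ : Module k W) (σ : W →ₗ[k] W ⊗[k] D)
      (j : V →ₗ[k] W), IsRightCoaction σ ∧ Function.Injective j ∧
        π.toLinearMap.lTensor W ∘ₗ σ ∘ₗ j = j.rTensor C ∘ₗ ρ

end Extension

/-! ### Coideal subalgebras, module factor coalgebras and Takeuchi's correspondence -/

section Hopf

variable {k : Type u} {H : Type v} [Field k] [Ring H]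

/-- `H` as a right module over a subalgebra `A`, by multiplication on the right. -/
instance rightModule [Algebra k H] (A : Subalgebra k H) : Module (A)ᵐᵒᵖ H where
  smul a h := h * (a.unop : H)
  one_smul h := mul_one h
  mul_smul a b h := (mul_assoc h (b.unop : H) (a.unop : H)).symm
  smul_zero a := zero_mul (a.unop : H)
  smul_add a x y := add_mul x y (a.unop : H)
  add_smul a b x := mul_add x (a.unop : H) (b.unop : H)
  zero_smul x := mul_zero x

/-- `I ⊗ H` is a left ideal of `H ⊗ H` if `I` is a left ideal of `H`. -/
lemma rTensor_mkQ_mul_eq_zero [Algebra k H] (I : Ideal H) (x y : H ⊗[k] H)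
    (hy : (I.restrictScalars k).mkQ.rTensor H y = 0) :
    (I.restrictScalars k).mkQ.rTensor H (x * y) = 0 := by
  induction x using TensorProduct.induction_on with
  | zero => simp
  | add x₁ x₂ h₁ h₂ => rw [add_mul, map_add, h₁, h₂, add_zero]
  | tmul a b =>
    have ha : I.restrictScalars k ≤ (I.restrictScalars k).comap (LinearMap.mulLeft k a) :=
      fun i hi => I.mul_mem_left a hi
    have key : (I.restrictScalars k).mkQ.rTensor H ((a ⊗ₜ[k] b) * y) =
        TensorProduct.map (Submodule.mapQ _ _ (LinearMap.mulLeft k a) ha) (LinearMap.mulLeft k b)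
          ((I.restrictScalars k).mkQ.rTensor H y) := by
      clear hy
      induction y using TensorProduct.induction_on with
      | zero => simp
      | add y₁ y₂ h₁ h₂ => rw [mul_add, map_add, map_add, map_add, h₁, h₂]
      | tmul c d => simp
    rw [key, hy, map_zero]

lemma rTensor_mkQ_mul_tmul [Algebra k H] (I : Ideal H) (x : H ⊗[k] H) (b : H) :
    (I.restrictScalars k).mkQ.rTensor H (x * (1 ⊗ₜ[k] b)) =
      (LinearMap.mulRight k b).lTensor _ ((I.restrictScalars k).mkQ.rTensor H x) := by
  induction x using TensorProduct.induction_on with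
  | zero => simp
  | add x₁ x₂ h₁ h₂ => rw [add_mul, map_add, map_add, map_add, h₁, h₂]
  | tmul a c => simp

variable [HopfAlgebra k H]

/-- `A` is a right coideal: `Δ(A) ⊆ A ⊗ H`. -/
def IsRightCoideal (A : Subalgebra k H) : Prop :=
  ∀ a ∈ A, Coalgebra.comul (R := k) a ∈
    LinearMap.range ((Subalgebra.toSubmodule A).subtype.rTensor H)

/-- `A` coincides with its dominion `{h ∈ H | h ⊗ 1 = 1 ⊗ h in H ⊗_A H}`. -/
def IsDominion (A : Subalgebra k H) : Prop :=
  (A : Set H) = {h : H | balancedTmul k A h (1 : H) = balancedTmul k A (1 : H) h}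

/-- Right coideal dominion subalgebras of `H` over which `H` is left flat. -/
def leftFlatDominions (k : Type u) (H : Type v) [Field k] [Ring H] [HopfAlgebra k H] :
    Set (Subalgebra k H) :=
  {A | IsRightCoideal A ∧ IsDominion A ∧ IsLeftFlat k A H}

/-- Right coideal dominion subalgebras of `H` over which `H` is right flat. -/
def rightFlatDominions (k : Type u) (H : Type v) [Field k] [Ring H] [HopfAlgebra k H] :
    Set (Subalgebra k H) :=
  {A | IsRightCoideal A ∧ IsDominion A ∧ IsRightFlat k A H}

/-- Left `H`-module factor coalgebras `C = H/I`, given by left ideals `I` that are coideals, such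
that all finite-dimensional left `C`-comodules embed in left `H`-comodules. -/
def leftEmbeddingFactors (k : Type u) (H : Type v) [Field k] [Ring H] [HopfAlgebra k H] :
    Set (Ideal H) :=
  {I | ∃ _ : (I.restrictScalars k).IsCoideal,
    LeftComodulesEmbed (Coalgebra.Quotient.mkQCoalgHom (R := k) (I.restrictScalars k))}

/-- Left `H`-module factor coalgebras `C = H/I`, given by left ideals `I` that are coideals, such
that all finite-dimensional right `C`-comodules embed in right `H`-comodules. -/
def rightEmbeddingFactors (k : Type u) (H : Type v) [Field k] [Ring H] [HopfAlgebra k H] :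
    Set (Ideal H) :=
  {I | ∃ _ : (I.restrictScalars k).IsCoideal,
    RightComodulesEmbed (Coalgebra.Quotient.mkQCoalgHom (R := k) (I.restrictScalars k))}

/-- The left ideal `H A⁺`, where `A⁺ = A ∩ Ker ε`; it represents the factor `H / H A⁺`. -/
def toFactor (A : Subalgebra k H) : Ideal H :=
  Ideal.span {a : H | a ∈ A ∧ Coalgebra.counit (R := k) a = 0}

/-- The subalgebra `{h ∈ H | (π ⊗ id) Δ(h) = π(1) ⊗ h}` of invariants under the left coaction of
`C = H/I` on `H`, where `π : H → H/I` is the canonical map. -/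
def coinvariants (I : Ideal H) : Subalgebra k H where
  carrier := {h : H | (I.restrictScalars k).mkQ.rTensor H (Coalgebra.comul (R := k) h) =
    (I.restrictScalars k).mkQ 1 ⊗ₜ[k] h}
  mul_mem' {a b} ha hb := by
    simp only [Set.mem_ofPred_eq] at ha hb ⊢
    have h1 : (I.restrictScalars k).mkQ.rTensor H
        (Coalgebra.comul (R := k) b - 1 ⊗ₜ[k] b) = 0 := by
      rw [map_sub, hb, LinearMap.rTensor_tmul, sub_self]
    have h2 := rTensor_mkQ_mul_eq_zero I (Coalgebra.comul (R := k) a) _ h1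
    rw [mul_sub, map_sub, sub_eq_zero] at h2
    rw [Bialgebra.comul_mul, h2, rTensor_mkQ_mul_tmul, ha, LinearMap.lTensor_tmul,
      LinearMap.mulRight_apply]
  add_mem' {a b} ha hb := by
    simp only [Set.mem_ofPred_eq] at ha hb ⊢
    rw [map_add, map_add, ha, hb, TensorProduct.tmul_add]
  algebraMap_mem' r := by
    simp only [Set.mem_ofPred_eq]
    rw [Bialgebra.comul_algebraMap, Algebra.algebraMap_eq_smul_one, Algebra.algebraMap_eq_smul_one,
      map_smul, Algebra.TensorProduct.one_def, LinearMap.rTensor_tmul, TensorProduct.tmul_smul]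

end Hopf

end Takeuchi

namespace Takeuchi

universe u v

open TensorProduct Coalgebra HopfAlgebra WithConv

/-! ### Linear algebra over a field -/

section LinearAlgebra

variable {k : Type*} [Field k]

/-! Write C = H/I, π for the projection and S for the antipode. The argument rests on one
intermediate condition, `HasLocalSections`: over each finite-dimensional subspace F of C there is a
linear h : C → H compatible on F with the left C-coactions and with the counits. It is equivalent to
the embedding condition for left comodules. Given h on the coefficient space of a comodule V, the
map (h ⊗ id)ρ embeds V in the cofree comodule H ⊗ V. Conversely F lies in a finite-dimensional left
coideal V; if V embeds in an H-comodule W, extend ε from V to a functional f on W and put h = (id ⊗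
f)σ on V.

For a right coideal subalgebra A and I = HA⁺, the map x ⊗ y ↦ π(x₁) ⊗ x₂y from H ⊗_A H to C ⊗ H is
inverted by π(x) ⊗ y ↦ x₁ ⊗ S(x₂)y. It carries h ⊗ 1 = 1 ⊗ h to the condition defining the
invariants, so A is a dominion exactly when the invariants of H/HA⁺ are A (`isDominion_iff`). One
composite is thereby the identity without any flatness.

From flatness to local sections: for a basis b_i of a left coideal with Δ(b_i) = ∑ d_ij ⊗ b_j, one
seeks m_i in H with coaction ∑ d_ij ⊗ m_j and ε(m_i) = ε(b_i). The coaction equations are right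
A-linear in m. They have a solution after applying ? ⊗_A H, namely the classes of x₁ ⊗ S(x₂) for b_i
= π(x). Left flatness rewrites this solution through genuine ones, and applying ε to the added
factor gives m.

From local sections back: with h now regarded as a map H → H killing I, consider d ↦ S(d₁)h(d₂)₁ ⊗
S(h(d₂)₂) (`sectionMap`). Locally its values lie in A ⊗ H with A the invariants (`sectionMap_mem`),
and multiplying its factors gives S(d). Applying id ⊗ ε yields an A-valued γ with ε ∘ γ = ε and
m₁γ(m₂) = h(m); for m in I the latter vanishes, so m = ∑ m₁(ε(m₂) − γ(m₂)) lies in HA⁺. Precomposing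
with the inverse of S gives local A-linear sections of A ⊗ H → H, which forces left flatness.

The right-handed half is the left-handed one for the opposite algebra. There right flatness becomes
left flatness, while S : H → Hᵒᵖ is an algebra isomorphism reversing comultiplication, so it matches
left ideals with left ideals and right comodules with left ones. -/

lemma ker_rTensor_eq_range {M N : Type*} (Q : Type*) [AddCommGroup M] [Module k M]
    [AddCommGroup N] [Module k N] [AddCommGroup Q] [Module k Q] (f : M →ₗ[k] N) :
    LinearMap.ker (f.rTensor Q) = LinearMap.range ((LinearMap.ker f).subtype.rTensor Q) :=
  LinearMap.exact_iff.mp (Module.Flat.rTensor_exact Q (LinearMap.exact_subtype_ker_map f))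

lemma ker_lTensor_eq_range {M N : Type*} (Q : Type*) [AddCommGroup M] [Module k M]
    [AddCommGroup N] [Module k N] [AddCommGroup Q] [Module k Q] (f : M →ₗ[k] N) :
    LinearMap.ker (f.lTensor Q) = LinearMap.range ((LinearMap.ker f).subtype.lTensor Q) :=
  LinearMap.exact_iff.mp (Module.Flat.lTensor_exact Q (LinearMap.exact_subtype_ker_map f))

/-- Membership in M ⊗ V is tested by slicing with functionals: modulo V every coordinate of `t` in a
basis of M is zero. -/
lemma mem_range_lTensor_of_forall_dual {M N : Type*} [AddCommGroup M] [Module k M]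
    [AddCommGroup N] [Module k N] (V : Submodule k N) (t : M ⊗[k] N)
    (h : ∀ g : M →ₗ[k] k, TensorProduct.lid k N (g.rTensor N t) ∈ V) :
    t ∈ LinearMap.range (V.subtype.lTensor M) := by
  have : V = LinearMap.ker V.mkQ := by simp
  have key : t ∈ LinearMap.ker (V.mkQ.lTensor M) := by
    rw [LinearMap.mem_ker]
    classical
    let b := Module.Basis.ofVectorSpace k M
    apply (TensorProduct.equivFinsuppOfBasisLeft b).injective
    rw [map_zero]
    ext i
    rw [TensorProduct.equivFinsuppOfBasisLeft_apply, Finsupp.zero_apply]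
    have h1 : TensorProduct.lid k _ ((b.coord i).rTensor _ (V.mkQ.lTensor M t)) =
        V.mkQ (TensorProduct.lid k N ((b.coord i).rTensor N t)) := by
      clear h
      induction t using TensorProduct.induction_on with
      | zero => simp
      | add x y hx hy => simp only [map_add, hx, hy]
      | tmul x y => simp
    rw [h1]
    exact (Submodule.Quotient.mk_eq_zero V).mpr (h _)
  rw [ker_lTensor_eq_range] at key
  rwa [this]

lemma exists_finite_range_le_rTensor {V M N : Type*} [AddCommGroup M] [Module k M]
    [AddCommGroup N] [Module k N] [AddCommGroup V] [Module k V] [FiniteDimensional k V]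
    (f : V →ₗ[k] M ⊗[k] N) :
    ∃ G : Submodule k M, FiniteDimensional k G ∧
      ∀ v, f v ∈ LinearMap.range (G.subtype.rTensor N) := by
  obtain ⟨G, hG, h⟩ := exists_finite_submodule_left_of_setFinite
    (Set.range (f ∘ Module.finBasis k V)) (Set.finite_range _)
  refine ⟨G, hG, fun v => ?_⟩
  rw [← (Module.finBasis k V).sum_repr v, map_sum]
  refine Submodule.sum_mem _ fun i _ => ?_
  rw [map_smul]
  exact Submodule.smul_mem _ _ (h ⟨i, rfl⟩)

lemma exists_finite_range_le_lTensor {V M N : Type*} [AddCommGroup M] [Module k M]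
    [AddCommGroup N] [Module k N] [AddCommGroup V] [Module k V] [FiniteDimensional k V]
    (f : V →ₗ[k] M ⊗[k] N) :
    ∃ G : Submodule k N, FiniteDimensional k G ∧
      ∀ v, f v ∈ LinearMap.range (G.subtype.lTensor M) := by
  obtain ⟨G, hG, h⟩ := exists_finite_submodule_right_of_setFinite
    (Set.range (f ∘ Module.finBasis k V)) (Set.finite_range _)
  refine ⟨G, hG, fun v => ?_⟩
  rw [← (Module.finBasis k V).sum_repr v, map_sum]
  refine Submodule.sum_mem _ fun i _ => ?_
  rw [map_smul]
  exact Submodule.smul_mem _ _ (h ⟨i, rfl⟩)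

lemma exists_comp_eq_of_mem_range {V M N : Type*} [AddCommGroup M] [Module k M]
    [AddCommGroup N] [Module k N] [AddCommGroup V] [Module k V] (f : V →ₗ[k] M) (i : N →ₗ[k] M)
    (h : ∀ v, f v ∈ LinearMap.range i) : ∃ g : V →ₗ[k] N, ∀ v, i (g v) = f v := by
  obtain ⟨s, hs⟩ := i.rangeRestrict.exists_rightInverse_of_surjective i.range_rangeRestrict
  refine ⟨s ∘ₗ f.codRestrict _ h, fun v => ?_⟩
  exact congrArg Subtype.val (LinearMap.congr_fun hs (f.codRestrict _ h v))

end LinearAlgebra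

/-! ### Embeddings of comodules and local sections -/

section Coideals

variable {k : Type*} {C : Type*} [Field k] [AddCommGroup C] [Module k C] [Coalgebra k C]

/-- Every finite-dimensional subspace of a coalgebra lies in a finite-dimensional left coideal. -/
lemma exists_finite_leftCoideal (F : Submodule k C) [FiniteDimensional k F] :
    ∃ V : Submodule k C, FiniteDimensional k V ∧ F ≤ V ∧
      ∀ v ∈ V, comul (R := k) v ∈ LinearMap.range (V.subtype.lTensor C) := by
  -- All slices (g ⊗ id)Δ(x) with x in F; the choice g = ε recovers F itself.
  let V : Submodule k C := Submodule.span k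
    {y | ∃ (g : C →ₗ[k] k) (x : F), y = TensorProduct.lid k C (g.rTensor C (comul (x : C)))}
  obtain ⟨G, hG, hFG⟩ := exists_finite_range_le_lTensor (comul (R := k) ∘ₗ F.subtype)
  have hVG : V ≤ G := by
    rw [Submodule.span_le]
    rintro _ ⟨g, x, rfl⟩
    obtain ⟨z, hz⟩ := hFG x
    simp only [LinearMap.coe_comp, Function.comp_apply, Submodule.subtype_apply] at hz
    rw [← hz]
    clear hz
    induction z using TensorProduct.induction_on with
    | zero => simp
    | add x y hx hy => rw [map_add, map_add, map_add]; exact G.add_mem hx hy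
    | tmul x y => simpa using G.smul_mem _ y.2
  refine ⟨V, Submodule.finiteDimensional_of_le hVG, fun x hx => ?_, fun v hv => ?_⟩
  · refine Submodule.subset_span ⟨counit, ⟨x, hx⟩, ?_⟩
    simp
  · induction hv using Submodule.span_induction with
    | zero => rw [map_zero]; exact Submodule.zero_mem _
    | add x y _ _ hx hy => rw [map_add]; exact Submodule.add_mem _ hx hy
    | smul a x _ hx => rw [map_smul]; exact Submodule.smul_mem _ _ hx
    | mem y hy =>
      obtain ⟨g, x, rfl⟩ := hy
      refine mem_range_lTensor_of_forall_dual V _ fun g' => ?_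
      -- By coassociativity, slicing Δ of a slice is again a slice, for the convolution product of
      -- the two functionals.
      refine Submodule.subset_span
        ⟨(TensorProduct.lid k k).toLinearMap ∘ₗ TensorProduct.map g g' ∘ₗ comul, x, ?_⟩
      have h1 : ∀ z : C ⊗[k] C,
          TensorProduct.lid k C (g'.rTensor C (comul (TensorProduct.lid k C (g.rTensor C z)))) =
          TensorProduct.lid k C (TensorProduct.map g
            ((TensorProduct.lid k C).toLinearMap ∘ₗ g'.rTensor C) (comul.lTensor C z)) := by
        intro z
        induction z using TensorProduct.induction_on with
        | zero => simp
        | add x y hx hy => simp only [map_add, hx, hy]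
        | tmul x y => simp
      have h2 : ∀ z : (C ⊗[k] C) ⊗[k] C,
          TensorProduct.lid k C (TensorProduct.map g
            ((TensorProduct.lid k C).toLinearMap ∘ₗ g'.rTensor C) (TensorProduct.assoc k C C C z)) =
          TensorProduct.lid k C (((TensorProduct.lid k k).toLinearMap ∘ₗ
            TensorProduct.map g g').rTensor C z) := by
        intro z
        induction z using TensorProduct.induction_on with
        | zero => simp
        | add x y hx hy => simp only [map_add, hx, hy]
        | tmul x y =>
          induction x using TensorProduct.induction_on with
          | zero => simp
          | add x₁ x₂ hx hy => simp only [map_add, add_tmul, hx, hy]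
          | tmul x z => simpa [mul_smul] using smul_comm _ _ _
      rw [h1, ← coassoc_apply, h2, ← LinearMap.rTensor_comp_apply, LinearMap.comp_assoc]

end Coideals

section Sections

variable {k : Type u} {D C : Type v} [Field k] [AddCommGroup D] [Module k D] [Coalgebra k D]
  [AddCommGroup C] [Module k C] [Coalgebra k C]

/-- On each finite-dimensional subspace of `C` there is a map to `D` preserving the left coaction
of `C` and the counits. -/
def HasLocalSections (π : D →ₗc[k] C) : Prop :=
  ∀ F : Submodule k C, FiniteDimensional k F → ∃ h : C →ₗ[k] D, ∀ c ∈ F,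
    π.toLinearMap.rTensor D (comul (h c)) = h.lTensor C (comul c) ∧
      counit (R := k) (h c) = counit (R := k) c

/-- The cofree left comodule on a vector space. -/
lemma isLeftCoaction_cofree (U : Type*) [AddCommGroup U] [Module k U] :
    IsLeftCoaction (C := D) ((TensorProduct.assoc k D D U).toLinearMap ∘ₗ
      (comul (R := k) (A := D)).rTensor U) where
  coassoc := by
    have h2 : ∀ (y : D ⊗[k] D) (u : U), TensorProduct.assoc k D D (D ⊗[k] U)
        ((comul (R := k) (A := D)).rTensor (D ⊗[k] U) (TensorProduct.assoc k D D U (y ⊗ₜ[k] u))) =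
        ((TensorProduct.assoc k D D U).toLinearMap ∘ₗ
          (TensorProduct.mk k (D ⊗[k] D) U).flip u).lTensor D
          (TensorProduct.assoc k D D D (comul.rTensor D y)) := by
      intro y u
      induction y using TensorProduct.induction_on with
      | zero => simp
      | add x y hx hy => simp only [map_add, add_tmul, hx, hy]
      | tmul a b =>
        simp only [assoc_tmul, LinearMap.rTensor_tmul]
        generalize comul (R := k) a = w
        induction w using TensorProduct.induction_on with
        | zero => simp
        | add x y hx hy => simp only [map_add, add_tmul, hx, hy]
        | tmul a b => simp
    have h3 : ∀ (y : D ⊗[k] D) (u : U), ((TensorProduct.assoc k D D U).toLinearMap ∘ₗ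
        (comul (R := k) (A := D)).rTensor U).lTensor D (TensorProduct.assoc k D D U (y ⊗ₜ[k] u)) =
        ((TensorProduct.assoc k D D U).toLinearMap ∘ₗ
          (TensorProduct.mk k (D ⊗[k] D) U).flip u).lTensor D
          (comul.lTensor D y) := by
      intro y u
      induction y using TensorProduct.induction_on with
      | zero => simp
      | add x y hx hy => simp only [map_add, add_tmul, hx, hy]
      | tmul a b => simp
    ext d u
    simp [h2, h3]
  counit := by
    have h2 : ∀ (y : D ⊗[k] D) (u : U), (counit (R := k) (A := D)).rTensor (D ⊗[k] U)
        (TensorProduct.assoc k D D U (y ⊗ₜ[k] u)) =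
        TensorProduct.assoc k k D U (counit.rTensor D y ⊗ₜ u) := by
      intro y u
      induction y using TensorProduct.induction_on with
      | zero => simp
      | add x y hx hy => simp only [map_add, add_tmul, hx, hy]
      | tmul a b => simp
    ext d u
    simp [h2]

/-- The embedding is (h ⊗ id)ρ into the cofree comodule D ⊗ V. It is colinear because h is so on the
coefficients of ρ, and injective because applying ε to D returns v. -/
theorem HasLocalSections.leftComodulesEmbed {π : D →ₗc[k] C} (hπ : HasLocalSections π) :
    LeftComodulesEmbed π := by
  intro V _ _ _ ρ hρ
  obtain ⟨F, hF, hFρ⟩ := exists_finite_range_le_rTensor ρ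
  obtain ⟨h, hh⟩ := hπ F hF
  have hinj : ∀ z ∈ LinearMap.range (F.subtype.rTensor V),
      counit.rTensor V (h.rTensor V z) = (counit (R := k) (A := C)).rTensor V z := by
    rintro _ ⟨z, rfl⟩
    induction z using TensorProduct.induction_on with
    | zero => simp
    | add x y hx hy => simp only [map_add, hx, hy]
    | tmul x y => simp [(hh x x.2).2]
  have hcol : ∀ z ∈ LinearMap.range (F.subtype.rTensor V),
      π.toLinearMap.rTensor (D ⊗[k] V) (TensorProduct.assoc k D D V
        (comul.rTensor V (h.rTensor V z))) =
      (h.rTensor V).lTensor C (TensorProduct.assoc k C C V (comul.rTensor V z)) := by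
    rintro _ ⟨z, rfl⟩
    induction z using TensorProduct.induction_on with
    | zero => simp
    | add x y hx hy => simp only [map_add, hx, hy]
    | tmul x y =>
      have h1 : ∀ w : D ⊗[k] D, π.toLinearMap.rTensor (D ⊗[k] V)
          (TensorProduct.assoc k D D V (w ⊗ₜ y)) =
          TensorProduct.assoc k C D V (π.toLinearMap.rTensor D w ⊗ₜ y) := by
        intro w
        induction w using TensorProduct.induction_on with
        | zero => simp
        | add x y hx hy => simp only [map_add, add_tmul, hx, hy]
        | tmul a b => simp
      have h2 : ∀ w : C ⊗[k] C, TensorProduct.assoc k C D V (h.lTensor C w ⊗ₜ y) =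
          (h.rTensor V).lTensor C (TensorProduct.assoc k C C V (w ⊗ₜ y)) := by
        intro w
        induction w using TensorProduct.induction_on with
        | zero => simp
        | add x y hx hy => simp only [map_add, add_tmul, hx, hy]
        | tmul a b => simp
      simp only [LinearMap.rTensor_tmul, Submodule.subtype_apply]
      rw [h1, (hh x x.2).1, h2]
  refine ⟨D ⊗[k] V, inferInstance, inferInstance, _, h.rTensor V ∘ₗ ρ,
    isLeftCoaction_cofree V, ?_, ?_⟩
  · have hc : ∀ v, counit.rTensor V (h.rTensor V (ρ v)) = (1 : k) ⊗ₜ[k] v := fun v => by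
      rw [hinj _ (hFρ v)]
      exact LinearMap.congr_fun hρ.counit v
    intro v w hvw
    have := (hc v).symm.trans ((congrArg (counit.rTensor V) hvw).trans (hc w))
    simpa using congrArg (TensorProduct.lid k V) this
  · ext v
    have := LinearMap.congr_fun hρ.coassoc v
    simp only [LinearMap.coe_comp, Function.comp_apply, LinearEquiv.coe_coe] at this ⊢
    rw [hcol _ (hFρ v), this, ← LinearMap.lTensor_comp_apply]

/-- The embedding hypothesis is applied to a left coideal V containing F. A linear form on W that
extends ε turns the coaction of W into a map W → D, which is restricted to V. -/
theorem LeftComodulesEmbed.hasLocalSections {π : D →ₗc[k] C} (hπ : LeftComodulesEmbed π) :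
    HasLocalSections π := by
  intro F hF
  obtain ⟨V, hV, hFV, hcomul⟩ := exists_finite_leftCoideal F
  -- `LeftComodulesEmbed` speaks of comodules in `Type (max u v)`, whereas V lies in `Type v`.
  let i : ULift.{u} V →ₗ[k] C := V.subtype ∘ₗ ULift.moduleEquiv.toLinearMap
  have hi : Function.Injective i :=
    V.injective_subtype.comp (ULift.moduleEquiv (R := k) (M := V)).injective
  obtain ⟨ρ, hρ⟩ := exists_comp_eq_of_mem_range (comul ∘ₗ i) (i.lTensor C) (fun v => by
    obtain ⟨z, hz⟩ := hcomul (v.down : C) v.down.2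
    refine ⟨ULift.moduleEquiv.symm.toLinearMap.lTensor C z, ?_⟩
    rw [← LinearMap.lTensor_comp_apply]
    exact hz)
  have hii : Function.Injective ((i.lTensor C).lTensor C) :=
    Module.Flat.lTensor_preserves_injective_linearMap _
      (Module.Flat.lTensor_preserves_injective_linearMap _ hi)
  have hρc : IsLeftCoaction ρ := by
    constructor
    · ext v
      apply hii
      have h1 : ∀ z : C ⊗[k] ULift.{u} V, (i.lTensor C).lTensor C
          (TensorProduct.assoc k C C _ (comul.rTensor _ z)) =
          TensorProduct.assoc k C C _ (comul.rTensor C (i.lTensor C z)) := by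
        intro z
        induction z using TensorProduct.induction_on with
        | zero => simp
        | add x y hx hy => simp only [map_add, hx, hy]
        | tmul a b =>
          simp only [LinearMap.rTensor_tmul, LinearMap.lTensor_tmul]
          generalize comul (R := k) a = w
          induction w using TensorProduct.induction_on with
          | zero => simp
          | add x y hx hy => simp only [map_add, add_tmul, hx, hy]
          | tmul a b => simp
      have h2 : (i.lTensor C) ∘ₗ ρ = comul ∘ₗ i := LinearMap.ext hρ
      simp only [LinearMap.coe_comp, Function.comp_apply, LinearEquiv.coe_coe]
      rw [h1, hρ, ← LinearMap.lTensor_comp_apply, h2, LinearMap.lTensor_comp_apply, hρ]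
      exact coassoc_apply _
    · ext v
      have hk : Function.Injective (i.lTensor k) :=
        Module.Flat.lTensor_preserves_injective_linearMap _ hi
      apply hk
      have h1 : ∀ z : C ⊗[k] ULift.{u} V, i.lTensor k ((counit (R := k)).rTensor _ z) =
          counit.rTensor C (i.lTensor C z) := by
        intro z
        induction z using TensorProduct.induction_on with
        | zero => simp
        | add x y hx hy => simp only [map_add, hx, hy]
        | tmul a b => simp
      simp only [LinearMap.coe_comp, Function.comp_apply]
      rw [h1, hρ]
      simp
  have : FiniteDimensional k (ULift.{u} V) :=
    Module.Finite.equiv (ULift.moduleEquiv (R := k) (M := V)).symm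
  obtain ⟨W, _, _, σ, j, hσ, hj, hjρ⟩ := hπ (ULift.{u} V) ρ hρc
  obtain ⟨r, hr⟩ := j.exists_leftInverse_of_injective (LinearMap.ker_eq_bot.mpr hj)
  obtain ⟨q, hq⟩ := i.exists_leftInverse_of_injective (LinearMap.ker_eq_bot.mpr hi)
  -- Here `r` retracts W onto V, so `f` extends the counit of V; `q` serves only to extend `h₀` from
  -- V to C.
  let f : W →ₗ[k] k := counit ∘ₗ i ∘ₗ r
  have hf : ∀ v, f (j v) = counit (i v) := fun v => by
    simp [f, show r (j v) = v from LinearMap.congr_fun hr v]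
  let Φ : D ⊗[k] W →ₗ[k] D := (TensorProduct.rid k D).toLinearMap ∘ₗ f.lTensor D
  let h₀ : ULift.{u} V →ₗ[k] D := Φ ∘ₗ σ ∘ₗ j
  have hh : ∀ v, (h₀ ∘ₗ q) (i v) = h₀ v := fun v => by
    simp [show q (i v) = v from LinearMap.congr_fun hq v]
  refine ⟨h₀ ∘ₗ q, fun c hc => ?_⟩
  obtain ⟨v, rfl⟩ : ∃ v, i v = c := ⟨⟨⟨c, hFV hc⟩⟩, rfl⟩
  rw [hh]
  constructor
  · have hcomp : ((h₀ ∘ₗ q).lTensor C) (comul (i v)) = h₀.lTensor C (ρ v) := by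
      rw [show comul (i v) = i.lTensor C (ρ v) from (hρ v).symm, ← LinearMap.lTensor_comp_apply]
      congr 2
      exact LinearMap.ext hh
    rw [hcomp]
    have h1 : ∀ z : D ⊗[k] W, π.toLinearMap.rTensor D (comul (Φ z)) =
        ((TensorProduct.rid k _).toLinearMap ∘ₗ f.lTensor (C ⊗[k] D))
          ((TensorProduct.assoc k C D W).symm (π.toLinearMap.rTensor (D ⊗[k] W)
            (TensorProduct.assoc k D D W (comul.rTensor W z)))) := by
      intro z
      induction z using TensorProduct.induction_on with
      | zero => simp
      | add x y hx hy => simp only [map_add, hx, hy]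
      | tmul a b =>
        simp only [Φ, LinearMap.coe_comp, Function.comp_apply, LinearMap.lTensor_tmul,
          LinearMap.rTensor_tmul, LinearEquiv.coe_coe, rid_tmul, map_smul]
        generalize comul (R := k) a = w
        induction w using TensorProduct.induction_on with
        | zero => simp
        | add x y hx hy => simp only [map_add, add_tmul, smul_add, hx, hy]
        | tmul a b => simp
    have h2 : ∀ (z : D ⊗[k] W), ((TensorProduct.rid k _).toLinearMap ∘ₗ f.lTensor (C ⊗[k] D))
          ((TensorProduct.assoc k C D W).symm (π.toLinearMap.rTensor (D ⊗[k] W)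
            (σ.lTensor D z))) = (Φ ∘ₗ σ).lTensor C (π.toLinearMap.rTensor W z) := by
      intro z
      induction z using TensorProduct.induction_on with
      | zero => simp
      | add x y hx hy => simp only [map_add, hx, hy]
      | tmul a b =>
        simp only [Φ, LinearMap.coe_comp, Function.comp_apply, LinearMap.lTensor_tmul,
          LinearMap.rTensor_tmul, LinearEquiv.coe_coe]
        generalize σ b = w
        induction w using TensorProduct.induction_on with
        | zero => simp
        | add x y hx hy => simp only [map_add, tmul_add, hx, hy]
        | tmul a b => simp
    have h3 := LinearMap.congr_fun hσ.coassoc (j v)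
    have h4 := LinearMap.congr_fun hjρ v
    simp only [LinearMap.coe_comp, Function.comp_apply, LinearEquiv.coe_coe] at h3 h4
    simp only [h₀, LinearMap.coe_comp, Function.comp_apply]
    rw [h1, h3, h2, h4, ← LinearMap.lTensor_comp_apply]
    rfl
  · have h1 : ∀ z : D ⊗[k] W, counit (R := k) (Φ z) =
        f (TensorProduct.lid k W (counit.rTensor W z)) := by
      intro z
      induction z using TensorProduct.induction_on with
      | zero => simp
      | add x y hx hy => simp only [map_add, hx, hy]
      | tmul a b => simp [Φ, mul_comm]
    have h2 := LinearMap.congr_fun hσ.counit (j v)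
    simp only [LinearMap.coe_comp, Function.comp_apply] at h2
    simp only [h₀, LinearMap.coe_comp, Function.comp_apply]
    rw [h1, h2]
    simp [hf]

end Sections

/-! ### Invariants, the ideal H A⁺, and the dominion as a space of invariants -/

section Balanced

variable {k : Type*} {A M N : Type*} [CommRing k] [Ring A]
  [AddCommGroup M] [Module k M] [Module Aᵐᵒᵖ M]
  [AddCommGroup N] [Module k N] [Module A N]

lemma mkQ_balancedRel_smul_tmul (m : M) (a : A) (n : N) :
    (balancedRel k A M N).mkQ ((MulOpposite.op a • m) ⊗ₜ n) =
      (balancedRel k A M N).mkQ (m ⊗ₜ (a • n)) := by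
  rw [← sub_eq_zero, ← map_sub]
  exact (Submodule.Quotient.mk_eq_zero _).mpr (Submodule.subset_span ⟨m, a, n, rfl⟩)

lemma balancedRel_le_ker {X : Type*} [AddCommGroup X] [Module k X] (f : M ⊗[k] N →ₗ[k] X)
    (hf : ∀ (m : M) (a : A) (n : N), f ((MulOpposite.op a • m) ⊗ₜ n) = f (m ⊗ₜ (a • n))) :
    balancedRel k A M N ≤ LinearMap.ker f := by
  rw [balancedRel, Submodule.span_le]
  rintro _ ⟨m, a, n, rfl⟩
  simp [hf]

end Balanced

section Ideals

variable {k : Type*} [Field k] {H B : Type*} [Ring H] [Algebra k H] [Ring B] [Algebra k B]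

/-- The kernel of `f ⊗ g` is a left ideal if the kernels of `f` and `g` are. -/
lemma map_mul_eq_zero {X Y : Type*} [AddCommGroup X] [Module k X] [AddCommGroup Y] [Module k Y]
    {f : H →ₗ[k] X} {g : B →ₗ[k] Y} (hf : ∀ a, ∃ f' : X →ₗ[k] X, ∀ x, f (a * x) = f' (f x))
    (hg : ∀ a, ∃ g' : Y →ₗ[k] Y, ∀ x, g (a * x) = g' (g x)) (x y : H ⊗[k] B)
    (hy : TensorProduct.map f g y = 0) : TensorProduct.map f g (x * y) = 0 := by
  induction x using TensorProduct.induction_on with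
  | zero => simp
  | add x₁ x₂ h₁ h₂ => rw [add_mul, map_add, h₁, h₂, add_zero]
  | tmul a b =>
    obtain ⟨f', hf'⟩ := hf a
    obtain ⟨g', hg'⟩ := hg b
    have key : TensorProduct.map f g ((a ⊗ₜ[k] b) * y) =
        TensorProduct.map f' g' (TensorProduct.map f g y) := by
      clear hy
      induction y using TensorProduct.induction_on with
      | zero => simp
      | add y₁ y₂ h₁ h₂ => rw [mul_add, map_add, map_add, map_add, h₁, h₂]
      | tmul c d => simp [hf', hg']
    rw [key, hy, map_zero]

lemma exists_mkQ_mul (I : Ideal H) (a : H) :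
    ∃ f' : (H ⧸ I.restrictScalars k) →ₗ[k] (H ⧸ I.restrictScalars k), ∀ x,
      (I.restrictScalars k).mkQ (a * x) = f' ((I.restrictScalars k).mkQ x) :=
  ⟨Submodule.mapQ _ _ (LinearMap.mulLeft k a) fun _ hi => I.mul_mem_left a hi, fun _ => rfl⟩

lemma exists_id_mul (a : B) :
    ∃ f' : B →ₗ[k] B, ∀ x, (LinearMap.id : B →ₗ[k] B) (a * x) = f' ((LinearMap.id : B →ₗ[k] B) x) :=
  ⟨LinearMap.mulLeft k a, fun _ => rfl⟩

/-- `I ⊗ B` is a left ideal of `H ⊗ B` if `I` is a left ideal of `H`. -/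
lemma mkQ_rTensor_mul_eq_zero (I : Ideal H) (x y : H ⊗[k] B)
    (hy : (I.restrictScalars k).mkQ.rTensor B y = 0) :
    (I.restrictScalars k).mkQ.rTensor B (x * y) = 0 :=
  map_mul_eq_zero (exists_mkQ_mul I) exists_id_mul x y hy

end Ideals

section Hopf

variable {k : Type u} {H : Type v} [Field k] [Ring H] [HopfAlgebra k H]

lemma mem_coinvariants {I : Ideal H} {h : H} : h ∈ coinvariants (k := k) I ↔
    (I.restrictScalars k).mkQ.rTensor H (comul (R := k) h) =
      (I.restrictScalars k).mkQ 1 ⊗ₜ[k] h := Iff.rfl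

/-- The linear map `h ↦ (π ⊗ id) Δ(h) - π(1) ⊗ h`, whose kernel is the space of invariants. -/
def coinvariantDefect (I : Ideal H) : H →ₗ[k] (H ⧸ I.restrictScalars k) ⊗[k] H :=
  (I.restrictScalars k).mkQ.rTensor H ∘ₗ comul -
    TensorProduct.mk k _ H ((I.restrictScalars k).mkQ 1)

lemma toSubmodule_coinvariants (I : Ideal H) :
    Subalgebra.toSubmodule (coinvariants (k := k) I) = LinearMap.ker (coinvariantDefect I) := by
  ext h
  rw [LinearMap.mem_ker, coinvariantDefect, LinearMap.sub_apply, sub_eq_zero]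
  exact mem_coinvariants

lemma assoc_coinvariantDefect_rTensor (I : Ideal H) (z : H ⊗[k] H) :
    TensorProduct.assoc k _ H H ((coinvariantDefect I).rTensor H z) =
      (I.restrictScalars k).mkQ.rTensor (H ⊗[k] H)
        (TensorProduct.assoc k H H H (comul.rTensor H z)) -
      (I.restrictScalars k).mkQ 1 ⊗ₜ z := by
  induction z using TensorProduct.induction_on with
  | zero => simp
  | add x y hx hy => simp only [map_add, hx, hy, tmul_add]; abel
  | tmul x y =>
    simp only [LinearMap.rTensor_tmul, coinvariantDefect, LinearMap.sub_apply, sub_tmul, map_sub,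
      LinearMap.coe_comp, Function.comp_apply, TensorProduct.mk_apply, assoc_tmul]
    congr 1
    generalize comul (R := k) x = w
    induction w using TensorProduct.induction_on with
    | zero => simp
    | add x y hx hy => simp only [map_add, add_tmul, hx, hy]
    | tmul a b => simp

/-- Over a field, A ⊗ H is the kernel of `coinvariantDefect` ⊗ id when A is the kernel of
`coinvariantDefect`. Coassociativity shows that Δ(a) lies in it. -/
theorem isRightCoideal_coinvariants (I : Ideal H) :
    IsRightCoideal (coinvariants (k := k) I) := by
  intro a ha
  rw [toSubmodule_coinvariants, ← ker_rTensor_eq_range, LinearMap.mem_ker]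
  apply (TensorProduct.assoc k _ H H).injective
  have h2 : ∀ z : H ⊗[k] H, (I.restrictScalars k).mkQ.rTensor (H ⊗[k] H) (comul.lTensor H z) =
      (comul (R := k)).lTensor _ ((I.restrictScalars k).mkQ.rTensor H z) := by
    intro z
    rw [← LinearMap.comp_apply, ← LinearMap.comp_apply, LinearMap.rTensor_comp_lTensor,
      LinearMap.lTensor_comp_rTensor]
  rw [assoc_coinvariantDefect_rTensor, coassoc_apply, h2, mem_coinvariants.mp ha, LinearMap.lTensor_tmul, sub_self, map_zero]

lemma mkQ_toFactor_apply {A : Subalgebra k H} {a : H} (ha : a ∈ A) :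
    ((toFactor A).restrictScalars k).mkQ a =
      counit (R := k) a • ((toFactor A).restrictScalars k).mkQ 1 := by
  rw [← map_smul, ← sub_eq_zero, ← map_sub]
  refine (Submodule.Quotient.mk_eq_zero _).mpr (Ideal.subset_span ⟨?_, ?_⟩)
  · exact A.sub_mem ha (A.smul_mem A.one_mem _)
  · simp

/-- Since a₁ lies in A, it is congruent to ε(a₁) modulo HA⁺, so π(a₁) ⊗ a₂ = π(1) ⊗ ε(a₁)a₂ = π(1) ⊗
a. -/
lemma le_coinvariants_toFactor {A : Subalgebra k H} (hA : IsRightCoideal A) :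
    A ≤ coinvariants (toFactor A) := by
  intro a ha
  rw [mem_coinvariants]
  obtain ⟨z, hz⟩ := hA a ha
  have h1 : ∀ z : (Subalgebra.toSubmodule A) ⊗[k] H,
      ((toFactor A).restrictScalars k).mkQ.rTensor H
        ((Subalgebra.toSubmodule A).subtype.rTensor H z) =
      ((toFactor A).restrictScalars k).mkQ 1 ⊗ₜ TensorProduct.lid k H
        (counit.rTensor H ((Subalgebra.toSubmodule A).subtype.rTensor H z)) := by
    intro z
    induction z using TensorProduct.induction_on with
    | zero => simp
    | add x y hx hy => simp only [map_add, hx, hy, tmul_add]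
    | tmul x y =>
      simp only [LinearMap.rTensor_tmul, Submodule.subtype_apply, lid_tmul]
      rw [mkQ_toFactor_apply x.2, TensorProduct.smul_tmul]
  rw [← hz, h1, hz]
  simp

/-- For a in A⁺ the invariance of a gives (π ⊗ π)Δ(a) = π(1) ⊗ π(a) = 0. Left multiples follow
because the kernel of π ⊗ π is a left ideal and Δ is multiplicative. -/
theorem isCoideal_toFactor {A : Subalgebra k H} (hA : IsRightCoideal A) :
    ((toFactor A).restrictScalars k).IsCoideal := by
  constructor
  · intro x (hx : x ∈ toFactor A)
    induction hx using Submodule.span_induction with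
    | mem x hx => exact hx.2
    | zero => simp
    | add x y _ _ hx hy => rw [map_add, hx, hy, add_zero]
    | smul a x _ hx => rw [smul_eq_mul, Bialgebra.counit_mul, hx, mul_zero]
  · intro x (hx : x ∈ toFactor A)
    induction hx using Submodule.span_induction with
    | mem x hx =>
      rw [← LinearMap.lTensor_comp_rTensor, LinearMap.comp_apply,
        mem_coinvariants.mp (le_coinvariants_toFactor hA hx.1), LinearMap.lTensor_tmul,
        mkQ_toFactor_apply hx.1, hx.2, zero_smul, tmul_zero]
    | zero => simp
    | add x y _ _ hx hy => rw [map_add, map_add, hx, hy, add_zero]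
    | smul a x _ hx =>
      rw [smul_eq_mul, Bialgebra.comul_mul]
      exact map_mul_eq_zero (exists_mkQ_mul _) (exists_mkQ_mul _) _ _ hx

/-- Right linearity of the left coaction over the invariants: Δ(a) − 1 ⊗ a is killed by π ⊗ id,
whose kernel is a left ideal, so it may be multiplied by Δ(x). -/
lemma mkQ_rTensor_comul_mul {I : Ideal H} {a : H} (ha : a ∈ coinvariants (k := k) I) (x : H) :
    (I.restrictScalars k).mkQ.rTensor H (comul (R := k) (x * a)) =
      (LinearMap.mulRight k a).lTensor _ ((I.restrictScalars k).mkQ.rTensor H (comul x)) := by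
  have h0 : (I.restrictScalars k).mkQ.rTensor H (comul (R := k) a - 1 ⊗ₜ a) = 0 := by
    rw [map_sub, mem_coinvariants.mp ha, LinearMap.rTensor_tmul, sub_self]
  have h1 := rTensor_mkQ_mul_eq_zero _ (comul (R := k) x) _ h0
  rw [mul_sub, map_sub, sub_eq_zero] at h1
  rw [Bialgebra.comul_mul, h1, rTensor_mkQ_mul_tmul]

/-- The map `x ↦ (y ↦ x₍₁₎ ⊗ S(x₍₂₎) y)` from `H` to `Hom(H, H ⊗_A H)`. -/
def preTranslation (A : Subalgebra k H) : H →ₗ[k] H →ₗ[k] BalancedTensor k A H H :=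
  ((LinearMap.mul k (H ⊗[k] H)).compl₁₂ ((HopfAlgebra.antipode k).lTensor H ∘ₗ comul)
    (TensorProduct.mk k H H 1)).compr₂ (balancedRel k A H H).mkQ

lemma preTranslation_apply (A : Subalgebra k H) (x y : H) : preTranslation A x y =
    (balancedRel k A H H).mkQ ((HopfAlgebra.antipode k).lTensor H (comul x) * (1 ⊗ₜ y)) := rfl

/-- In x₁a₁ ⊗ S(a₂)S(x₂)y the factor a₁ lies in A and crosses the tensor sign, where a₁S(a₂)
collapses to ε(a). -/
lemma preTranslation_mul {A : Subalgebra k H} (hA : IsRightCoideal A) {a : H} (ha : a ∈ A)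
    (x : H) : preTranslation A (x * a) = counit (R := k) a • preTranslation A x := by
  ext y
  rw [LinearMap.smul_apply, preTranslation_apply, preTranslation_apply, Bialgebra.comul_mul]
  obtain ⟨w, hw⟩ := hA a ha
  generalize comul (R := k) x = z
  induction z using TensorProduct.induction_on with
  | zero => simp
  | add z₁ z₂ h₁ h₂ => simp only [add_mul, map_add, h₁, h₂, smul_add]
  | tmul p q =>
    have key : ∀ w : (Subalgebra.toSubmodule A) ⊗[k] H, (balancedRel k A H H).mkQ
        ((HopfAlgebra.antipode k).lTensor H ((p ⊗ₜ q) *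
          (Subalgebra.toSubmodule A).subtype.rTensor H w) * (1 ⊗ₜ y)) =
        (balancedRel k A H H).mkQ (p ⊗ₜ (LinearMap.mul' k H ((HopfAlgebra.antipode k).lTensor H
          ((Subalgebra.toSubmodule A).subtype.rTensor H w)) *
            (HopfAlgebra.antipode k q * y))) := by
      intro w
      induction w using TensorProduct.induction_on with
      | zero => simp
      | add z₁ z₂ h₁ h₂ => simp only [mul_add, add_mul, map_add, h₁, h₂, tmul_add]
      | tmul a' h =>
        have := mkQ_balancedRel_smul_tmul (k := k) (A := A) (M := H) (N := H) p
          ⟨a'.1, a'.2⟩ (HopfAlgebra.antipode k (q * h) * y)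
        simp only [LinearMap.rTensor_tmul, Submodule.subtype_apply, LinearMap.lTensor_tmul,
          Algebra.TensorProduct.tmul_mul_tmul, mul_one, LinearMap.mul'_apply]
        refine this.trans ?_
        congr 2
        change a'.1 * _ = _
        rw [HopfAlgebra.antipode_mul_antidistrib]
        simp only [mul_assoc]
    rw [← hw, key, hw, HopfAlgebra.mul_antipode_lTensor_comul_apply, ← Algebra.smul_def, tmul_smul,
      map_smul]
    simp

lemma preTranslation_eq_zero {A : Subalgebra k H} (hA : IsRightCoideal A) {x : H}
    (hx : x ∈ toFactor A) : preTranslation A x = 0 := by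
  -- The statement is strengthened to all left multiples so that induction over the left ideal
  -- passes through scalar multiplication by H.
  suffices h : ∀ c : H, preTranslation A (c * x) = 0 by simpa using h 1
  induction hx using Submodule.span_induction with
  | mem x hx => intro c; rw [preTranslation_mul hA hx.1, hx.2, zero_smul]
  | zero => simp
  | add x y _ _ hx hy => intro c; rw [mul_add, map_add, hx, hy, add_zero]
  | smul a x _ hx => intro c; rw [smul_eq_mul, ← mul_assoc, hx]

/-- The map `π(x) ↦ (y ↦ x₍₁₎ ⊗ S(x₍₂₎) y)` from `H / H A⁺` to `Hom(H, H ⊗_A H)`. -/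
def translation {A : Subalgebra k H} (hA : IsRightCoideal A) :
    (H ⧸ (toFactor A).restrictScalars k) →ₗ[k] H →ₗ[k] BalancedTensor k A H H :=
  Submodule.liftQ _ (preTranslation A) fun _ hx => preTranslation_eq_zero hA hx

lemma translation_mkQ {A : Subalgebra k H} (hA : IsRightCoideal A) (x : H) :
    translation hA (((toFactor A).restrictScalars k).mkQ x) = preTranslation A x := rfl

/-- The elements equalized by the two maps to `H ⊗_A H` are the invariants of `H / H A⁺`. -/
theorem mem_coinvariants_toFactor_iff {A : Subalgebra k H} (hA : IsRightCoideal A) (h : H) :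
    h ∈ coinvariants (k := k) (toFactor A) ↔
      balancedTmul k A h (1 : H) = balancedTmul k A (1 : H) h := by
  constructor
  · intro hh
    -- Applying the translation map to π(h₁) ⊗ h₂ = π(1) ⊗ h gives h₁ ⊗ S(h₂)h₃ = h ⊗ 1 on the left
    -- and 1 ⊗ h on the right.
    have h1 : ∀ z : H ⊗[k] H, TensorProduct.lift (translation hA)
        (((toFactor A).restrictScalars k).mkQ.rTensor H z) =
        (balancedRel k A H H).mkQ ((LinearMap.mul' k H ∘ₗ
          (HopfAlgebra.antipode k).rTensor H).lTensor H (TensorProduct.assoc k H H H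
            (comul.rTensor H z))) := by
      intro z
      induction z using TensorProduct.induction_on with
      | zero => simp
      | add x y hx hy => simp only [map_add, hx, hy]
      | tmul x y =>
        simp only [LinearMap.rTensor_tmul, lift.tmul, translation_mkQ, preTranslation_apply]
        congr 1
        generalize comul (R := k) x = w
        induction w using TensorProduct.induction_on with
        | zero => simp
        | add x y hx hy => simp only [map_add, add_tmul, add_mul, hx, hy]
        | tmul a b => simp
    have h2 := h1 (comul h)
    rw [mem_coinvariants.mp hh, lift.tmul, translation_mkQ, preTranslation_apply, coassoc_apply,
      ← LinearMap.lTensor_comp_apply, LinearMap.comp_assoc,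
      HopfAlgebra.mul_antipode_rTensor_comul, LinearMap.lTensor_comp_apply,
      lTensor_counit_comul] at h2
    simp only [Bialgebra.comul_one, Algebra.TensorProduct.one_def, LinearMap.lTensor_tmul,
      HopfAlgebra.antipode_one, Algebra.TensorProduct.tmul_mul_tmul, one_mul,
      Algebra.linearMap_apply, map_one] at h2
    exact h2.symm
  · intro hh
    -- The canonical map x ⊗ y ↦ π(x₁) ⊗ x₂y. It is A-balanced and carries h ⊗ 1 = 1 ⊗ h to the
    -- invariance of h.
    let can : H ⊗[k] H →ₗ[k] (H ⧸ (toFactor A).restrictScalars k) ⊗[k] H :=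
      ((toFactor A).restrictScalars k).mkQ.rTensor H ∘ₗ LinearMap.mul' k (H ⊗[k] H) ∘ₗ
        TensorProduct.map comul (TensorProduct.mk k H H 1)
    have hcan : ∀ x y : H, can (x ⊗ₜ y) =
        ((toFactor A).restrictScalars k).mkQ.rTensor H (comul x * (1 ⊗ₜ y)) := fun x y => rfl
    have hle : balancedRel k A H H ≤ LinearMap.ker can := by
      refine balancedRel_le_ker can fun x a y => ?_
      rw [hcan, hcan, rTensor_mkQ_mul_tmul, rTensor_mkQ_mul_tmul]
      change LinearMap.lTensor _ _ (LinearMap.rTensor _ _ (comul (x * (a : H)))) =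
        (LinearMap.mulRight k ((a : H) * y)).lTensor _ _
      rw [mkQ_rTensor_comul_mul (le_coinvariants_toFactor hA a.2), ← LinearMap.lTensor_comp_apply,
        LinearMap.mulRight_mul]
    have h5 : h ⊗ₜ[k] (1 : H) - 1 ⊗ₜ h ∈ LinearMap.ker can :=
      hle ((Submodule.Quotient.eq _).mp hh)
    rw [LinearMap.mem_ker, map_sub, sub_eq_zero, hcan, hcan] at h5
    rw [mem_coinvariants]
    simpa [Algebra.TensorProduct.one_def.symm, Bialgebra.comul_one] using h5

theorem isDominion_iff {A : Subalgebra k H} (hA : IsRightCoideal A) :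
    IsDominion A ↔ coinvariants (toFactor A) = A := by
  rw [IsDominion, Set.ext_iff, SetLike.ext_iff]
  exact forall_congr' fun h =>
    ⟨fun e => (mem_coinvariants_toFactor_iff hA h).trans e.symm,
      fun e => e.symm.trans (mem_coinvariants_toFactor_iff hA h)⟩

end Hopf

/-! ### Left flatness produces local sections -/

section Flat

variable {k : Type u} {A N : Type v} [Field k] [Ring A] [Algebra k A]
  [AddCommGroup N] [Module k N] [Module A N]

lemma balancedRTensor_mkQ {M M' : Type*}
    [AddCommGroup M] [Module k M] [Module Aᵐᵒᵖ M] [IsScalarTower k Aᵐᵒᵖ M]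
    [AddCommGroup M'] [Module k M'] [Module Aᵐᵒᵖ M'] [IsScalarTower k Aᵐᵒᵖ M']
    (f : M →ₗ[Aᵐᵒᵖ] M') (z : M ⊗[k] N) :
    balancedRTensor N f ((balancedRel k A M N).mkQ z) =
      (balancedRel k A M' N).mkQ ((f.restrictScalars k).rTensor N z) := rfl

/-- Tensoring with a flat module is exact. -/
lemma IsLeftFlat.mem_span_of_eq_zero (hN : IsLeftFlat k A N) {M M' : Type (max u v)}
    [AddCommGroup M] [Module k M] [Module Aᵐᵒᵖ M] [IsScalarTower k Aᵐᵒᵖ M]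
    [AddCommGroup M'] [Module k M'] [Module Aᵐᵒᵖ M'] [IsScalarTower k Aᵐᵒᵖ M']
    (g : M →ₗ[Aᵐᵒᵖ] M') (t : BalancedTensor k A M N) (ht : balancedRTensor N g t = 0) :
    t ∈ Submodule.span k {x | ∃ m n, g m = 0 ∧ x = balancedTmul k A m n} := by
  obtain ⟨z, rfl⟩ := Submodule.mkQ_surjective _ t
  -- Flatness is applied to the injection M/K → M', so `t` already vanishes in (M/K) ⊗_A N. It
  -- remains to lift the relations from M/K to M.
  set K := LinearMap.ker g with hK
  let q : M →ₗ[Aᵐᵒᵖ] M ⧸ K := K.mkQ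
  let g' : M ⧸ K →ₗ[Aᵐᵒᵖ] M' := K.liftQ g le_rfl
  have hg' : Function.Injective g' := by
    rw [← LinearMap.ker_eq_bot]
    exact Submodule.ker_liftQ_eq_bot' _ _ rfl
  have hz : (balancedRel k A (M ⧸ K) N).mkQ ((q.restrictScalars k).rTensor N z) = 0 := by
    apply hN (M ⧸ K) M' g' hg'
    rw [map_zero, balancedRTensor_mkQ, ← LinearMap.rTensor_comp_apply, ← ht]
    rfl
  have hle : balancedRel k A (M ⧸ K) N ≤
      (balancedRel k A M N).map ((q.restrictScalars k).rTensor N) := by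
    rw [balancedRel, Submodule.span_le]
    rintro _ ⟨m, a, n, rfl⟩
    obtain ⟨m, rfl⟩ := K.mkQ_surjective m
    exact ⟨_, Submodule.subset_span ⟨m, a, n, rfl⟩, by simp [q]⟩
  obtain ⟨y, hy, hyz⟩ := hle ((Submodule.Quotient.mk_eq_zero _).mp hz)
  have h1 : z - y ∈ LinearMap.ker ((q.restrictScalars k).rTensor N) := by
    rw [LinearMap.mem_ker, map_sub, hyz, sub_self]
  rw [ker_rTensor_eq_range] at h1
  obtain ⟨w, hw⟩ := h1
  have h2 : (balancedRel k A M N).mkQ z = (balancedRel k A M N).mkQ (z - y) := by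
    rw [map_sub, show (balancedRel k A M N).mkQ y = 0 from
      (Submodule.Quotient.mk_eq_zero _).mpr hy, sub_zero]
  rw [h2, ← hw]
  clear hw h2
  induction w using TensorProduct.induction_on with
  | zero => rw [map_zero, map_zero]; exact Submodule.zero_mem _
  | add x y hx hy => rw [map_add, map_add]; exact Submodule.add_mem _ hx hy
  | tmul m n =>
    refine Submodule.subset_span ⟨m.1, n, ?_, rfl⟩
    have : q m.1 = 0 := m.2
    rwa [Submodule.mkQ_apply, Submodule.Quotient.mk_eq_zero] at this

end Flat

section Hopf

variable {k : Type u} {H : Type v} [Field k] [Ring H]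

instance isScalarTower_rightModule [Algebra k H] (A : Subalgebra k H) :
    IsScalarTower k (A)ᵐᵒᵖ H where
  smul_assoc c a h := mul_smul_comm c h (a.unop : H)

lemma op_smul_eq_mul [Algebra k H] {A : Subalgebra k H} (a : A) (h : H) :
    MulOpposite.op a • h = h * (a : H) := rfl

variable [HopfAlgebra k H] (A : Subalgebra k H)

/-- The left coaction of `H / H A⁺` on `H`, with its values written in `H ⊗ (H / H A⁺)`, is a map
of right `A`-modules. -/
def flipCoaction {A : Subalgebra k H} (hA : IsRightCoideal A) :
    H →ₗ[(A)ᵐᵒᵖ] H ⊗[k] (H ⧸ (toFactor A).restrictScalars k) where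
  toFun x := TensorProduct.comm k _ H (((toFactor A).restrictScalars k).mkQ.rTensor H (comul x))
  map_add' x y := by simp only [map_add]
  map_smul' a x := by
    obtain ⟨a⟩ := a
    change TensorProduct.comm k _ H
      (((toFactor A).restrictScalars k).mkQ.rTensor H (comul (x * (a : H)))) = _
    rw [mkQ_rTensor_comul_mul (le_coinvariants_toFactor hA a.2)]
    generalize ((toFactor A).restrictScalars k).mkQ.rTensor H (comul x) = z
    induction z using TensorProduct.induction_on with
    | zero => simp
    | add x y hx hy => simp only [map_add, smul_add, hx, hy]
    | tmul x y => rfl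

/-- The map `x ↦ x ⊗ c` of right `A`-modules. -/
def tmulRight {C : Type*} [AddCommGroup C] [Module k C] (c : C) : H →ₗ[(A)ᵐᵒᵖ] H ⊗[k] C where
  toFun x := x ⊗ₜ c
  map_add' x y := add_tmul x y c
  map_smul' _ _ := rfl

variable {A} in
lemma flipCoaction_apply (hA : IsRightCoideal A) (x : H) : flipCoaction hA x =
    TensorProduct.comm k _ H (((toFactor A).restrictScalars k).mkQ.rTensor H (comul x)) := rfl

lemma tmulRight_apply {C : Type*} [AddCommGroup C] [Module k C] (c : C) (x : H) :
    tmulRight A c x = x ⊗ₜ[k] c := rfl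

/-- The canonical map from `C ⊗ (H ⊗_A H)` to `(H ⊗ C) ⊗_A H`. -/
def insertMiddle (C : Type*) [AddCommGroup C] [Module k C] :
    C ⊗[k] BalancedTensor k A H H →ₗ[k] BalancedTensor k A (H ⊗[k] C) H :=
  TensorProduct.lift (LinearMap.mk₂ k (fun c t => balancedRTensor H (tmulRight A c) t)
    (fun c c' t => by
      obtain ⟨z, rfl⟩ := Submodule.mkQ_surjective _ t
      simp only [balancedRTensor_mkQ, ← map_add]
      congr 1
      induction z using TensorProduct.induction_on with
      | zero => simp
      | add x y hx hy => simp only [map_add, hx, hy]; abel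
      | tmul x y => simp [tmulRight_apply, tmul_add, add_tmul])
    (fun a c t => by
      obtain ⟨z, rfl⟩ := Submodule.mkQ_surjective _ t
      simp only [balancedRTensor_mkQ, ← map_smul]
      congr 1
      induction z using TensorProduct.induction_on with
      | zero => simp
      | add x y hx hy => simp only [map_add, smul_add, hx, hy]
      | tmul x y => simp [tmulRight_apply, smul_tmul'])
    (fun c t t' => map_add _ t t')
    (fun a c t => map_smul _ a t))

variable {A}

/-- For c = π(x), coassociativity makes both sides the class of (x₂ ⊗ π(x₁)) ⊗ S(x₃). Thus c ↦ x₁ ⊗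
S(x₂) respects left coactions, which is what makes it a solution over H. -/
lemma balancedRTensor_flipCoaction_translation (hA : IsRightCoideal A)
    [((toFactor A).restrictScalars k).IsCoideal]
    (c : H ⧸ (toFactor A).restrictScalars k) :
    balancedRTensor H (flipCoaction hA) (translation hA c 1) =
      insertMiddle A _ (((translation hA).flip 1).lTensor _ (comul (R := k) c)) := by
  obtain ⟨x, rfl⟩ := Submodule.mkQ_surjective _ c
  let Θ : H ⊗[k] (H ⊗[k] H) →ₗ[k] (H ⊗[k] (H ⧸ (toFactor A).restrictScalars k)) ⊗[k] H :=
    (TensorProduct.comm k _ H).toLinearMap.rTensor H ∘ₗ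
      (TensorProduct.assoc k _ H H).symm.toLinearMap ∘ₗ
      TensorProduct.map ((toFactor A).restrictScalars k).mkQ
        ((HopfAlgebra.antipode k).lTensor H)
  have h1 : ∀ z : H ⊗[k] H, ((flipCoaction hA).restrictScalars k).rTensor H
      ((HopfAlgebra.antipode k).lTensor H z) =
      Θ (TensorProduct.assoc k H H H (comul.rTensor H z)) := by
    intro z
    induction z using TensorProduct.induction_on with
    | zero => simp
    | add x y hx hy => simp only [map_add, hx, hy]
    | tmul p q =>
      simp only [LinearMap.lTensor_tmul, LinearMap.rTensor_tmul, LinearMap.restrictScalars_apply,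
        flipCoaction_apply]
      generalize comul (R := k) p = w
      induction w using TensorProduct.induction_on with
      | zero => simp
      | add x y hx hy => simp only [map_add, add_tmul, hx, hy]
      | tmul a b => simp [Θ]
  have h2 : ∀ z : H ⊗[k] H, insertMiddle A _ (((translation hA).flip 1).lTensor _
      (TensorProduct.map ((toFactor A).restrictScalars k).mkQ
        ((toFactor A).restrictScalars k).mkQ z)) =
      (balancedRel k A _ H).mkQ (Θ (comul.lTensor H z)) := by
    intro z
    induction z using TensorProduct.induction_on with
    | zero => simp
    | add x y hx hy => simp only [map_add, hx, hy]
    | tmul p q =>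
      simp only [TensorProduct.map_tmul, LinearMap.lTensor_tmul, LinearMap.flip_apply,
        translation_mkQ, preTranslation_apply, insertMiddle, lift.tmul, LinearMap.mk₂_apply,
        balancedRTensor_mkQ, ← Algebra.TensorProduct.one_def, mul_one]
      congr 1
      generalize comul (R := k) q = w
      induction w using TensorProduct.induction_on with
      | zero => simp
      | add x y hx hy => simp only [map_add, tmul_add, hx, hy]
      | tmul a b => simp [Θ, tmulRight_apply]
  rw [translation_mkQ, preTranslation_apply, ← Algebra.TensorProduct.one_def, mul_one,
    balancedRTensor_mkQ, h1, coassoc_apply, ← h2]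
  rfl

section Solutions

variable (A) {ι : Type u}

/-- The map `m ⊗ y ↦ (ε(m_i) ε(y))_i` on `Hⁿ ⊗_A H`. -/
def piCounit : BalancedTensor k A (ι → H) H →ₗ[k] (ι → k) :=
  Submodule.liftQ _ (LinearMap.pi fun i => LinearMap.mul' k k ∘ₗ
      TensorProduct.map (counit ∘ₗ LinearMap.proj i) counit)
    (balancedRel_le_ker _ fun m a n => by
      ext i
      simp only [LinearMap.pi_apply, LinearMap.coe_comp, Function.comp_apply, map_tmul,
        LinearMap.proj_apply, LinearMap.mul'_apply]
      rw [Pi.smul_apply, op_smul_eq_mul, Bialgebra.counit_mul,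
        show a • n = (a : H) * n from rfl, Bialgebra.counit_mul, mul_assoc])

lemma piCounit_mkQ_tmul (m : ι → H) (y : H) (i : ι) :
    piCounit A ((balancedRel k A (ι → H) H).mkQ (m ⊗ₜ y)) i =
      counit (R := k) (m i) * counit (R := k) y := rfl

variable {A}

lemma piCounit_single_translation [DecidableEq ι] (hA : IsRightCoideal A)
    [((toFactor A).restrictScalars k).IsCoideal] (i j : ι)
    (c : H ⧸ (toFactor A).restrictScalars k) :
    piCounit A (balancedRTensor H (LinearMap.single (A)ᵐᵒᵖ (fun _ => H) i)
      (translation hA c 1)) j = if j = i then counit (R := k) c else 0 := by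
  obtain ⟨x, rfl⟩ := Submodule.mkQ_surjective _ c
  have h2 : ∀ z : H ⊗[k] H, piCounit A ((balancedRel k A (ι → H) H).mkQ
      (((LinearMap.single (A)ᵐᵒᵖ (fun _ : ι => H) i).restrictScalars k).rTensor H
        ((HopfAlgebra.antipode k).lTensor H z))) j =
      if j = i then counit (R := k) (TensorProduct.lid k H (counit.rTensor H z)) else 0 := by
    intro z
    induction z using TensorProduct.induction_on with
    | zero => simp
    | add x y hx hy => simp only [map_add, Pi.add_apply, hx, hy]; split_ifs <;> simp
    | tmul x y =>
      rw [LinearMap.lTensor_tmul, LinearMap.rTensor_tmul, piCounit_mkQ_tmul,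
        LinearMap.restrictScalars_apply, LinearMap.single_apply, Pi.single_apply]
      split_ifs <;> simp
  rw [translation_mkQ, preTranslation_apply, ← Algebra.TensorProduct.one_def, mul_one,
    balancedRTensor_mkQ, h2, rTensor_counit_comul, lid_tmul, one_smul]
  rfl

variable (A) in
/-- The map `f ↦ (flip λ(f_i) - ∑ f_j ⊗ d_ij)_i` of right `A`-modules, for the left coaction `λ`
of `H / H A⁺` on `H`. -/
def solutionMap [Fintype ι] (hA : IsRightCoideal A) (d : ι → ι → H ⧸ (toFactor A).restrictScalars k) :
    (ι → H) →ₗ[(A)ᵐᵒᵖ] (ι → H ⊗[k] (H ⧸ (toFactor A).restrictScalars k)) :=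
  LinearMap.pi fun i => flipCoaction hA ∘ₗ LinearMap.proj i -
    ∑ j, tmulRight A (d i j) ∘ₗ LinearMap.proj j

lemma solutionMap_apply [Fintype ι] (hA : IsRightCoideal A)
    (d : ι → ι → H ⧸ (toFactor A).restrictScalars k) (f : ι → H) (i : ι) :
    solutionMap A hA d f i = flipCoaction hA (f i) - ∑ j, f j ⊗ₜ d i j := by
  simp [solutionMap, tmulRight_apply]

lemma balancedRTensor_solutionMap_single [Fintype ι] [DecidableEq ι] (hA : IsRightCoideal A)
    (d : ι → ι → H ⧸ (toFactor A).restrictScalars k) (i : ι) (t : BalancedTensor k A H H) :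
    balancedRTensor H (solutionMap A hA d)
      (balancedRTensor H (LinearMap.single (A)ᵐᵒᵖ (fun _ => H) i) t) =
      balancedRTensor H (LinearMap.single (A)ᵐᵒᵖ (fun _ => H ⊗[k] _) i)
        (balancedRTensor H (flipCoaction hA) t) -
      ∑ j, balancedRTensor H (LinearMap.single (A)ᵐᵒᵖ (fun _ => H ⊗[k] _) j)
        (balancedRTensor H (tmulRight A (d j i)) t) := by
  obtain ⟨z, rfl⟩ := Submodule.mkQ_surjective _ t
  simp only [balancedRTensor_mkQ, ← map_sum, ← map_sub]
  congr 1
  induction z using TensorProduct.induction_on with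
  | zero => simp
  | add x y hx hy => simp only [map_add, hx, hy, Finset.sum_add_distrib]; abel
  | tmul x y =>
    simp only [LinearMap.rTensor_tmul, ← sum_tmul, ← sub_tmul, LinearMap.restrictScalars_apply]
    congr 1
    ext j
    rw [solutionMap_apply]
    simp only [LinearMap.single_apply, tmulRight_apply, Pi.sub_apply, Finset.sum_apply,
      Pi.single_apply]
    congr 1
    · split_ifs <;> simp
    · simp [ite_tmul]

/-- The system is the kernel of the A-linear `solutionMap`. The translation map solves it in Hⁿ ⊗_A
H, and by flatness this solution is a sum of tensors m ⊗ n with m a solution in Hⁿ. -/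
lemma exists_solution_of_isLeftFlat [Fintype ι] (hA : IsRightCoideal A)
    [((toFactor A).restrictScalars k).IsCoideal] (hflat : IsLeftFlat k A H)
    (b : ι → H ⧸ (toFactor A).restrictScalars k) (d : ι → ι → H ⧸ (toFactor A).restrictScalars k)
    (hd : ∀ i, comul (R := k) (b i) = ∑ j, d i j ⊗ₜ b j) :
    ∃ m : ι → H, ∀ i, flipCoaction hA (m i) = ∑ j, m j ⊗ₜ d i j ∧
      counit (R := k) (m i) = counit (R := k) (b i) := by
  classical
  let t : BalancedTensor k A (ι → H) H :=
    ∑ i, balancedRTensor H (LinearMap.single (A)ᵐᵒᵖ (fun _ => H) i) (translation hA (b i) 1)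
  have ht : balancedRTensor H (solutionMap A hA d) t = 0 := by
    simp only [t, map_sum, balancedRTensor_solutionMap_single, Finset.sum_sub_distrib]
    rw [Finset.sum_comm, ← Finset.sum_sub_distrib]
    refine Finset.sum_eq_zero fun i _ => ?_
    rw [balancedRTensor_flipCoaction_translation, hd, map_sum, map_sum, map_sum, sub_eq_zero]
    rfl
  have htm := hflat.mem_span_of_eq_zero _ t ht
  have hEt : ∀ i, piCounit A t i = counit (R := k) (b i) := by
    intro i
    simp only [t, map_sum, Finset.sum_apply, piCounit_single_translation]
    simp
  -- Each m ⊗ n is replaced by ε(n)m. Solutions form a k-subspace, and the counits of the components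
  -- are those recorded by `piCounit`.
  obtain ⟨m, hgm, hm⟩ : ∃ m, solutionMap A hA d m = 0 ∧
      ∀ i, counit (R := k) (m i) = piCounit A t i := by
    clear hEt ht
    clear_value t
    induction htm using Submodule.span_induction with
    | mem x hx =>
      obtain ⟨m, n, hm, rfl⟩ := hx
      refine ⟨counit (R := k) n • m, by rw [LinearMap.map_smul_of_tower, hm, smul_zero],
        fun i => ?_⟩
      rw [balancedTmul, piCounit_mkQ_tmul, Pi.smul_apply, map_smul, smul_eq_mul, mul_comm]
    | zero => exact ⟨0, by simp, by simp⟩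
    | add x y _ _ hx hy =>
      obtain ⟨m, hm, hm'⟩ := hx
      obtain ⟨n, hn, hn'⟩ := hy
      exact ⟨m + n, by rw [map_add, hm, hn, add_zero], fun i => by simp [hm', hn']⟩
    | smul a x _ hx =>
      obtain ⟨m, hm, hm'⟩ := hx
      exact ⟨a • m, by rw [LinearMap.map_smul_of_tower, hm, smul_zero], fun i => by simp [hm']⟩
  refine ⟨m, fun i => ⟨?_, (hm i).trans (hEt i)⟩⟩
  have h2 := congrFun hgm i
  rwa [solutionMap_apply, Pi.zero_apply, sub_eq_zero] at h2

end Solutions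

theorem hasLocalSections_of_isLeftFlat (hA : IsRightCoideal A)
    [((toFactor A).restrictScalars k).IsCoideal] (hflat : IsLeftFlat k A H) :
    HasLocalSections (Coalgebra.Quotient.mkQCoalgHom (R := k) ((toFactor A).restrictScalars k)) := by
  classical
  intro F hF
  obtain ⟨V, hV, hFV, hcomul⟩ := exists_finite_leftCoideal F
  -- The index type is lifted to `Type u` so that Hⁿ lies in `Type (max u v)`, the universe over
  -- which `IsLeftFlat` quantifies.
  let b := (Module.finBasis k V).reindex Equiv.ulift.{u}.symm
  have hd : ∀ i, ∃ d : ULift.{u} (Fin (Module.finrank k V)) →₀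
      H ⧸ (toFactor A).restrictScalars k,
      comul (R := k) (b i : H ⧸ (toFactor A).restrictScalars k) =
        ∑ j, d j ⊗ₜ (b j : H ⧸ (toFactor A).restrictScalars k) := by
    intro i
    obtain ⟨z, hz⟩ := hcomul _ (b i).2
    obtain ⟨d, hd⟩ := TensorProduct.eq_repr_basis_right b z
    refine ⟨d, ?_⟩
    rw [← hz, ← hd, Finsupp.sum_fintype _ _ (by simp)]
    simp
  choose d hd using hd
  obtain ⟨m, hm⟩ := exists_solution_of_isLeftFlat hA hflat
    (fun i => (b i : H ⧸ (toFactor A).restrictScalars k)) (fun i j => d i j) hd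
  obtain ⟨h, hh⟩ := (b.constr k m).exists_extend
  have hhb : ∀ i, h (b i) = m i := fun i => by
    have := LinearMap.congr_fun hh (b i)
    simpa using this
  refine ⟨h, fun c hc => ⟨?_, ?_⟩⟩
  · have h1 : ((toFactor A).restrictScalars k).mkQ.rTensor H ∘ₗ comul ∘ₗ h ∘ₗ V.subtype =
        h.lTensor _ ∘ₗ comul ∘ₗ V.subtype := by
      refine b.ext fun i => ?_
      simp only [LinearMap.coe_comp, Function.comp_apply, Submodule.subtype_apply]
      apply (TensorProduct.comm k _ H).injective
      rw [hhb, hd]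
      refine (hm i).1.trans ?_
      simp [hhb]
    exact LinearMap.congr_fun h1 ⟨c, hFV hc⟩
  · have h1 : counit ∘ₗ h ∘ₗ V.subtype = counit ∘ₗ V.subtype := by
      refine b.ext fun i => ?_
      simp [hhb, (hm i).2]
    exact LinearMap.congr_fun h1 ⟨c, hFV hc⟩

end Hopf

/-! ### A flatness criterion through local sections of the action -/

section FlatCriterion

variable {k : Type u} {A N : Type v} [Field k] [Ring A]
  [AddCommGroup N] [Module k N] [Module A N]

/-- A membership in `balancedRel` involves finitely many relations. Hence a section that is linear
only on a finite-dimensional subspace can be used. -/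
lemma exists_finite_mem_span_of_mem_balancedRel {M : Type*} [AddCommGroup M] [Module k M]
    [Module Aᵐᵒᵖ M] {y : M ⊗[k] N} (hy : y ∈ balancedRel k A M N) :
    ∃ G : Submodule k N, FiniteDimensional k G ∧ y ∈ Submodule.span k
      {t | ∃ (m : M) (a : A) (n : N), n ∈ G ∧ a • n ∈ G ∧
        t = (MulOpposite.op a • m) ⊗ₜ[k] n - m ⊗ₜ[k] (a • n)} := by
  induction hy using Submodule.span_induction with
  | mem x hx =>
    obtain ⟨m, a, n, rfl⟩ := hx
    exact ⟨Submodule.span k {n, a • n}, FiniteDimensional.span_of_finite k (Set.toFinite _),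
      Submodule.subset_span ⟨m, a, n, Submodule.subset_span (by simp),
        Submodule.subset_span (by simp), rfl⟩⟩
  | zero => exact ⟨⊥, inferInstance, Submodule.zero_mem _⟩
  | add x y _ _ hx hy =>
    obtain ⟨G, hG, hx⟩ := hx
    obtain ⟨G', hG', hy⟩ := hy
    refine ⟨G ⊔ G', inferInstance, Submodule.add_mem _ (Submodule.span_mono ?_ hx)
      (Submodule.span_mono ?_ hy)⟩
    · rintro _ ⟨m, a, n, h, h', rfl⟩
      exact ⟨m, a, n, Submodule.mem_sup_left h, Submodule.mem_sup_left h', rfl⟩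
    · rintro _ ⟨m, a, n, h, h', rfl⟩
      exact ⟨m, a, n, Submodule.mem_sup_right h, Submodule.mem_sup_right h', rfl⟩
  | smul a x _ hx =>
    obtain ⟨G, hG, hx⟩ := hx
    exact ⟨G, hG, Submodule.smul_mem _ _ hx⟩

variable [Algebra k A] [IsScalarTower k A N]

/-- A left module is flat if its action map `A ⊗ N → N` has local `A`-linear sections. -/
theorem isLeftFlat_of_local_sections
    (h : ∀ G : Submodule k N, FiniteDimensional k G → ∃ δ : N →ₗ[k] A ⊗[k] N,
      (∀ n ∈ G, TensorProduct.lift (Algebra.lsmul k k N).toLinearMap (δ n) = n) ∧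
      ∀ (a : A), ∀ n ∈ G, a • n ∈ G → δ (a • n) = a • δ n) : IsLeftFlat k A N := by
  intro M M' _ _ _ _ _ _ _ _ f hf
  rw [← LinearMap.ker_eq_bot, LinearMap.ker_eq_bot']
  intro t ht
  obtain ⟨z, rfl⟩ := Submodule.mkQ_surjective _ t
  rw [balancedRTensor_mkQ] at ht
  obtain ⟨G₁, hG₁, hz'⟩ := exists_finite_mem_span_of_mem_balancedRel
    ((Submodule.Quotient.mk_eq_zero _).mp ht)
  obtain ⟨G₂, hG₂, hz⟩ := exists_finite_submodule_right_of_setFinite {z} (Set.finite_singleton z)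
  obtain ⟨w, hw⟩ := hz rfl
  obtain ⟨δ, hδ, hδA⟩ := h (G₁ ⊔ G₂) inferInstance
  let act (X : Type (max u v)) [AddCommGroup X] [Module k X] [Module Aᵐᵒᵖ X]
      [IsScalarTower k Aᵐᵒᵖ X] : X ⊗[k] A →ₗ[k] X :=
    TensorProduct.lift (LinearMap.mk₂ k (fun m a => MulOpposite.op a • m)
      (fun m m' a => smul_add _ m m') (fun c m a => smul_comm _ c m)
      (fun m a a' => by rw [MulOpposite.op_add, add_smul])
      (fun c m a => by rw [MulOpposite.op_smul, smul_assoc]))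
  -- The map x ⊗ n ↦ ∑ xa ⊗ n' for δ(n) = ∑ a ⊗ n'. It is natural in X, kills the relations
  -- supported on `G₁`, and is the identity modulo relations on M ⊗ (`G₁ ⊔ G₂`). So ω(z) maps to 0
  -- under f ⊗ id, which is injective over k, and z ≡ ω(z) = 0.
  let ω (X : Type (max u v)) [AddCommGroup X] [Module k X] [Module Aᵐᵒᵖ X]
      [IsScalarTower k Aᵐᵒᵖ X] : X ⊗[k] N →ₗ[k] X ⊗[k] N :=
    (act X).rTensor N ∘ₗ (TensorProduct.assoc k X A N).symm.toLinearMap ∘ₗ δ.lTensor X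
  have hωf : ∀ y, ω M' ((f.restrictScalars k).rTensor N y) =
      (f.restrictScalars k).rTensor N (ω M y) := by
    intro y
    induction y using TensorProduct.induction_on with
    | zero => simp
    | add x y hx hy => simp only [map_add, hx, hy]
    | tmul x y =>
      simp only [ω, LinearMap.coe_comp, Function.comp_apply, LinearMap.lTensor_tmul,
        LinearMap.rTensor_tmul, LinearEquiv.coe_coe, LinearMap.restrictScalars_apply]
      generalize δ y = w
      induction w using TensorProduct.induction_on with
      | zero => simp
      | add x y hx hy => simp only [map_add, tmul_add, hx, hy]
      | tmul a b => simp [act]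
  have hωrel : ω M' ((f.restrictScalars k).rTensor N z) = 0 := by
    have hle : Submodule.span k {t | ∃ (m : M') (a : A) (n : N), n ∈ G₁ ∧ a • n ∈ G₁ ∧
        t = (MulOpposite.op a • m) ⊗ₜ[k] n - m ⊗ₜ[k] (a • n)} ≤ LinearMap.ker (ω M') := by
      rw [Submodule.span_le]
      rintro _ ⟨m, a, n, hn, han, rfl⟩
      rw [SetLike.mem_coe, LinearMap.mem_ker, map_sub, sub_eq_zero]
      simp only [ω, LinearMap.coe_comp, Function.comp_apply, LinearMap.lTensor_tmul,
        LinearEquiv.coe_coe]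
      rw [hδA a n (Submodule.mem_sup_left hn) (Submodule.mem_sup_left han)]
      generalize δ n = w
      induction w using TensorProduct.induction_on with
      | zero => simp
      | add x y hx hy => simp only [map_add, smul_add, tmul_add, hx, hy]
      | tmul x b => simp [act, smul_tmul', mul_smul]
    exact hle hz'
  have hωz : ω M z = 0 := by
    apply Module.Flat.rTensor_preserves_injective_linearMap (M := N) (f.restrictScalars k) hf
    rw [← hωf, hωrel, map_zero]
  have hmk : (balancedRel k A M N).mkQ (ω M z) = (balancedRel k A M N).mkQ z := by
    rw [← hw]
    clear hw
    induction w using TensorProduct.induction_on with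
    | zero => simp
    | add x y hx hy => simp only [map_add] at hx hy ⊢; rw [hx, hy]
    | tmul m n =>
      have hmul : ∀ w : A ⊗[k] N, (balancedRel k A M N).mkQ
          ((act M).rTensor N ((TensorProduct.assoc k M A N).symm (m ⊗ₜ w))) =
          (balancedRel k A M N).mkQ
            (m ⊗ₜ TensorProduct.lift (Algebra.lsmul k k N).toLinearMap w) := by
        intro w
        induction w using TensorProduct.induction_on with
        | zero => simp
        | add x y hx hy => simp only [map_add, tmul_add, hx, hy]
        | tmul a b => exact mkQ_balancedRel_smul_tmul m a b
      rw [LinearMap.lTensor_tmul]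
      refine (hmul _).trans ?_
      rw [Submodule.subtype_apply, hδ _ (Submodule.mem_sup_right n.2)]
  rw [← hmk, hωz, map_zero]

end FlatCriterion

/-! ### The antipode and its inverse -/

section Antipode

variable {k : Type*} {H : Type*} [Field k] [Ring H] [HopfAlgebra k H]

/-- With the next lemma: an algebra map f is invertible under convolution, with inverse f ∘ S. -/
lemma algHom_antipode_convMul {R : Type*} [Ring R] [Algebra k R] (f : H →ₐ[k] R) :
    toConv (f.toLinearMap ∘ₗ antipode k) * toConv f.toLinearMap = 1 := by
  have := LinearMap.algHom_comp_convMul_distrib f (toConv (antipode k (A := H)))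
    (toConv LinearMap.id)
  rw [LinearMap.antipode_mul_id] at this
  apply ofConv_injective
  rw [show toConv f.toLinearMap = toConv (f.toLinearMap ∘ₗ LinearMap.id) by simp]
  refine this.symm.trans ?_
  ext x
  simp

lemma algHom_convMul_antipode {R : Type*} [Ring R] [Algebra k R] (f : H →ₐ[k] R) :
    toConv f.toLinearMap * toConv (f.toLinearMap ∘ₗ antipode k) = 1 := by
  have := LinearMap.algHom_comp_convMul_distrib f (toConv LinearMap.id)
    (toConv (antipode k (A := H)))
  rw [LinearMap.id_mul_antipode] at this
  apply ofConv_injective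
  rw [show toConv f.toLinearMap = toConv (f.toLinearMap ∘ₗ LinearMap.id) by simp]
  refine this.symm.trans ?_
  ext x
  simp

lemma comul_eq_convMul : toConv (comul (R := k) (A := H)) =
    toConv (Algebra.TensorProduct.includeLeft : H →ₐ[k] H ⊗[k] H).toLinearMap *
      toConv (Algebra.TensorProduct.includeRight : H →ₐ[k] H ⊗[k] H).toLinearMap := by
  apply ofConv_injective
  have h : LinearMap.mul' k (H ⊗[k] H) ∘ₗ TensorProduct.map
      (Algebra.TensorProduct.includeLeft : H →ₐ[k] H ⊗[k] H).toLinearMap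
      (Algebra.TensorProduct.includeRight : H →ₐ[k] H ⊗[k] H).toLinearMap = LinearMap.id := by
    ext x y
    simp
  change _ = _ ∘ₗ _ ∘ₗ _
  rw [← LinearMap.comp_assoc, ofConv_toConv, ofConv_toConv, h]
  rfl

/-- The antipode is an antihomomorphism of coalgebras. -/
lemma comul_antipode (x : H) : comul (R := k) (antipode k x) =
    TensorProduct.comm k H H (TensorProduct.map (antipode k) (antipode k) (comul x)) := by
  let j₁ : H →ₐ[k] H ⊗[k] H := Algebra.TensorProduct.includeLeft
  let j₂ : H →ₐ[k] H ⊗[k] H := Algebra.TensorProduct.includeRight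
  have h1 : toConv (j₂.toLinearMap ∘ₗ antipode k) * toConv (j₁.toLinearMap ∘ₗ antipode k) =
      toConv ((TensorProduct.comm k H H).toLinearMap ∘ₗ
        TensorProduct.map (antipode k) (antipode k) ∘ₗ comul) := by
    apply ofConv_injective
    change _ ∘ₗ _ ∘ₗ _ = _
    rw [← LinearMap.comp_assoc, ofConv_toConv, ofConv_toConv, ofConv_toConv, ← LinearMap.comp_assoc]
    congr 1
    ext x y
    simp [j₁, j₂]
  -- As Δ is the convolution product of the two inclusions, the flipped S ⊗ S is its left inverse; Δ
  -- ∘ S is a right inverse, and the two agree.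
  have h2 : toConv ((TensorProduct.comm k H H).toLinearMap ∘ₗ
        TensorProduct.map (antipode k) (antipode k) ∘ₗ comul) *
      toConv (comul (R := k) (A := H)) = 1 := by
    rw [← h1, comul_eq_convMul, mul_assoc, ← mul_assoc (toConv (j₁.toLinearMap ∘ₗ _)),
      algHom_antipode_convMul, one_mul, algHom_antipode_convMul]
  have h3 := left_inv_eq_right_inv h2 LinearMap.comul_right_inv
  exact (LinearMap.congr_fun (toConv_injective h3) x).symm

variable (hS : Function.Bijective (antipode k : H →ₗ[k] H))

/-- The inverse of a bijective antipode. -/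
noncomputable def antipodeInv : H →ₗ[k] H := (LinearEquiv.ofBijective _ hS).symm.toLinearMap

lemma antipode_antipodeInv (x : H) : antipode k (antipodeInv hS x) = x :=
  (LinearEquiv.ofBijective _ hS).apply_symm_apply x

lemma antipodeInv_antipode (x : H) : antipodeInv hS (antipode k x) = x :=
  (LinearEquiv.ofBijective _ hS).symm_apply_apply x

lemma antipodeInv_mul (x y : H) :
    antipodeInv hS (x * y) = antipodeInv hS y * antipodeInv hS x := by
  apply hS.1
  simp only [antipode_mul_antidistrib, antipode_antipodeInv]

lemma comul_antipodeInv (x : H) : comul (R := k) (antipodeInv hS x) =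
    TensorProduct.comm k H H
      (TensorProduct.map (antipodeInv hS) (antipodeInv hS) (comul x)) := by
  have h := comul_antipode (k := k) (antipodeInv hS x)
  rw [antipode_antipodeInv] at h
  have h1 : ∀ z : H ⊗[k] H, TensorProduct.comm k H H (TensorProduct.map (antipodeInv hS)
      (antipodeInv hS) (TensorProduct.comm k H H
        (TensorProduct.map (antipode k) (antipode k) z))) = z := by
    intro z
    induction z using TensorProduct.induction_on with
    | zero => simp
    | add x y hx hy => simp only [map_add, hx, hy]
    | tmul x y => simp [antipodeInv_antipode]
  rw [h, h1]

/-- The identity S⁻¹(x₂)x₁ = ε(x) becomes S(x₁)x₂ = ε(x) after applying S, which is injective and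
reverses products. -/
lemma mul_antipodeInv_comul (x : H) : LinearMap.mul' k H (TensorProduct.comm k H H
    ((antipodeInv hS).lTensor H (comul (R := k) x))) = algebraMap k H (counit x) := by
  apply hS.1
  have h1 : ∀ z : H ⊗[k] H, antipode k (LinearMap.mul' k H (TensorProduct.comm k H H
      ((antipodeInv hS).lTensor H z))) = LinearMap.mul' k H ((antipode k).rTensor H z) := by
    intro z
    induction z using TensorProduct.induction_on with
    | zero => simp
    | add x y hx hy => simp only [map_add, hx, hy]
    | tmul x y => simp [antipode_mul_antidistrib, antipode_antipodeInv]
  rw [h1, mul_antipode_rTensor_comul_apply, Algebra.algebraMap_eq_smul_one, map_smul, antipode_one]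

/-- Modulo `H A⁺` the inverse of the antipode agrees on `A` with the counit. -/
lemma mkQ_toFactor_antipodeInv {A : Subalgebra k H} (hA : IsRightCoideal A) {a : H} (ha : a ∈ A) :
    ((toFactor A).restrictScalars k).mkQ (antipodeInv hS a) =
      counit (R := k) a • ((toFactor A).restrictScalars k).mkQ 1 := by
  obtain ⟨w, hw⟩ := hA a ha
  -- In S⁻¹(a₂)a₁ = ε(a) the right factor a₁ lies in A and may be replaced by ε(a₁) modulo the left
  -- ideal, leaving S⁻¹(a).
  have h1 : ∀ w : (Subalgebra.toSubmodule A) ⊗[k] H, ((toFactor A).restrictScalars k).mkQ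
      (LinearMap.mul' k H (TensorProduct.comm k H H ((antipodeInv hS).lTensor H
        ((Subalgebra.toSubmodule A).subtype.rTensor H w)))) =
      ((toFactor A).restrictScalars k).mkQ (antipodeInv hS (TensorProduct.lid k H
        (counit.rTensor H ((Subalgebra.toSubmodule A).subtype.rTensor H w)))) := by
    intro w
    induction w using TensorProduct.induction_on with
    | zero => simp
    | add x y hx hy => simp only [map_add, hx, hy]
    | tmul x y =>
      obtain ⟨f, hf⟩ := exists_mkQ_mul (k := k) (toFactor A) (antipodeInv hS y)
      simp only [LinearMap.rTensor_tmul, LinearMap.lTensor_tmul, comm_tmul, LinearMap.mul'_apply,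
        Submodule.subtype_apply, lid_tmul, map_smul]
      rw [hf, mkQ_toFactor_apply x.2, map_smul, ← hf, mul_one]
  have h2 := h1 w
  rw [hw, mul_antipodeInv_comul, rTensor_counit_comul, lid_tmul, one_smul] at h2
  rw [← h2, Algebra.algebraMap_eq_smul_one, map_smul]

end Antipode

/-! ### Local sections recover the ideal and give flatness -/

section Section

variable {k : Type u} {H : Type v} [Field k] [Ring H] [HopfAlgebra k H]

/-- The map `x ↦ x₍₁₎ ⊗ S(x₍₂₎)`. -/
def comulAntipode : H →ₗ[k] H ⊗[k] H := (antipode k).lTensor H ∘ₗ comul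

lemma rid_counit_comulAntipode (x y : H) : TensorProduct.rid k H
    (counit.lTensor H ((x ⊗ₜ[k] (1 : H)) * comulAntipode y)) = x * y := by
  have h1 : ∀ z : H ⊗[k] H, TensorProduct.rid k H
      (counit.lTensor H ((x ⊗ₜ[k] (1 : H)) * (antipode k).lTensor H z)) =
      x * TensorProduct.rid k H (counit.lTensor H z) := by
    intro z
    induction z using TensorProduct.induction_on with
    | zero => simp
    | add x y hx hy => simp only [map_add, mul_add, hx, hy]
    | tmul x y => simp
  rw [comulAntipode, LinearMap.comp_apply, h1, lTensor_counit_comul, rid_tmul, one_smul]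

lemma mul'_comulAntipode (x y : H) : LinearMap.mul' k H
    ((x ⊗ₜ[k] (1 : H)) * comulAntipode y) = counit (R := k) y • x := by
  have h1 : ∀ z : H ⊗[k] H, LinearMap.mul' k H ((x ⊗ₜ[k] (1 : H)) * z) =
      x * LinearMap.mul' k H z := by
    intro z
    induction z using TensorProduct.induction_on with
    | zero => simp
    | add x y hx hy => simp only [map_add, mul_add, hx, hy]
    | tmul x y => simp [mul_assoc]
  rw [h1, comulAntipode, LinearMap.comp_apply, mul_antipode_lTensor_comul_apply,
    Algebra.algebraMap_eq_smul_one, mul_smul_comm, mul_one]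

/-- The map `d ↦ S(d₍₁₎) h(d₍₂₎)₍₁₎ ⊗ S(h(d₍₂₎)₍₂₎)`. -/
def sectionMap (h : H →ₗ[k] H) : H →ₗ[k] H ⊗[k] H :=
  LinearMap.mul' k (H ⊗[k] H) ∘ₗ TensorProduct.map
    ((Algebra.TensorProduct.includeLeft : H →ₐ[k] H ⊗[k] H).toLinearMap ∘ₗ antipode k)
    (comulAntipode ∘ₗ h) ∘ₗ comul

/-- The product of the two factors is S(d₁)h(d₂)₁S(h(d₂)₂) = S(d₁)ε(h(d₂)) = S(d). Only the values
of h on right-hand factors of Δ(d) enter. -/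
lemma mul'_sectionMap {h : H →ₗ[k] H} {G : Submodule k H}
    (hG : ∀ x ∈ G, counit (R := k) (h x) = counit (R := k) x) {d : H}
    (hd : comul (R := k) d ∈ LinearMap.range (G.subtype.lTensor H)) :
    LinearMap.mul' k H (sectionMap h d) = antipode k d := by
  obtain ⟨w, hw⟩ := hd
  have h1 : ∀ w : H ⊗[k] G, LinearMap.mul' k H (LinearMap.mul' k (H ⊗[k] H) (TensorProduct.map
      ((Algebra.TensorProduct.includeLeft : H →ₐ[k] H ⊗[k] H).toLinearMap ∘ₗ antipode k)
      (comulAntipode ∘ₗ h) (G.subtype.lTensor H w))) =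
      antipode k (TensorProduct.rid k H (counit.lTensor H (G.subtype.lTensor H w))) := by
    intro w
    induction w using TensorProduct.induction_on with
    | zero => simp
    | add x y hx hy => simp only [map_add, hx, hy]
    | tmul x y =>
      simp only [LinearMap.lTensor_tmul, Submodule.subtype_apply, TensorProduct.map_tmul,
        LinearMap.mul'_apply, LinearMap.coe_comp, Function.comp_apply,
        AlgHom.toLinearMap_apply, Algebra.TensorProduct.includeLeft_apply, rid_tmul, map_smul]
      rw [mul'_comulAntipode, hG _ y.2]
  rw [sectionMap, LinearMap.comp_apply, LinearMap.comp_apply, ← hw, h1, hw, lTensor_counit_comul,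
    rid_tmul, one_smul]

/-- S⁻¹ reverses comultiplication, so the first factor becomes S(d₁S⁻¹(a₂)) = a₂S(d₁), while
h(d₂S⁻¹(a₁)) = ε(a₁)h(d₂) because h kills HA⁺. This becomes left A-linearity once d is written as
S⁻¹(n). -/
lemma sectionMap_mul_antipodeInv (hS : Function.Bijective (antipode k : H →ₗ[k] H))
    {A : Subalgebra k H} (hA : IsRightCoideal A) {h : H →ₗ[k] H}
    (hh : ∀ x ∈ toFactor A, h x = 0) (d : H) {a : H} (ha : a ∈ A) :
    sectionMap h (d * antipodeInv hS a) = (a ⊗ₜ 1) * sectionMap h d := by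
  have hh' : ∀ q : H, ∀ x ∈ A, h (q * antipodeInv hS x) = counit (R := k) x • h q := by
    intro q x hx
    have h1 := mkQ_toFactor_antipodeInv hS hA hx
    rw [← map_smul, ← sub_eq_zero, ← map_sub] at h1
    have h2 : antipodeInv hS x - counit (R := k) x • 1 ∈ toFactor A :=
      (Submodule.Quotient.mk_eq_zero _).mp h1
    have h3 := hh _ ((toFactor A).mul_mem_left q h2)
    rwa [mul_sub, map_sub, sub_eq_zero, mul_smul_comm, mul_one, map_smul] at h3
  obtain ⟨w, hw⟩ := hA a ha
  have h1 : ∀ (z : H ⊗[k] H) (w : (Subalgebra.toSubmodule A) ⊗[k] H),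
      LinearMap.mul' k (H ⊗[k] H) (TensorProduct.map
        ((Algebra.TensorProduct.includeLeft : H →ₐ[k] H ⊗[k] H).toLinearMap ∘ₗ antipode k)
        (comulAntipode ∘ₗ h) (z * TensorProduct.comm k H H
          (TensorProduct.map (antipodeInv hS) (antipodeInv hS)
            ((Subalgebra.toSubmodule A).subtype.rTensor H w)))) =
      (TensorProduct.lid k H (counit.rTensor H
        ((Subalgebra.toSubmodule A).subtype.rTensor H w)) ⊗ₜ 1) *
      LinearMap.mul' k (H ⊗[k] H) (TensorProduct.map
        ((Algebra.TensorProduct.includeLeft : H →ₐ[k] H ⊗[k] H).toLinearMap ∘ₗ antipode k)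
        (comulAntipode ∘ₗ h) z) := by
    intro z w
    induction z using TensorProduct.induction_on with
    | zero => simp
    | add x y hx hy => simp only [map_add, add_mul, mul_add, hx, hy]
    | tmul p q =>
      induction w using TensorProduct.induction_on with
      | zero => simp
      | add x y hx hy => simp only [map_add, add_mul, mul_add, add_tmul, hx, hy]
      | tmul x y =>
        simp only [LinearMap.rTensor_tmul, Submodule.subtype_apply, TensorProduct.map_tmul,
          comm_tmul, Algebra.TensorProduct.tmul_mul_tmul, LinearMap.mul'_apply,
          LinearMap.coe_comp, Function.comp_apply, AlgHom.toLinearMap_apply,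
          Algebra.TensorProduct.includeLeft_apply, lid_tmul, antipode_mul_antidistrib,
          antipode_antipodeInv]
        rw [hh' q x x.2, map_smul, mul_smul_comm, ← smul_tmul', smul_mul_assoc, ← mul_assoc,
          Algebra.TensorProduct.tmul_mul_tmul, one_mul]
  rw [sectionMap, LinearMap.comp_apply, LinearMap.comp_apply, Bialgebra.comul_mul,
    comul_antipodeInv, ← hw, h1, hw, rTensor_counit_comul, lid_tmul, one_smul]
  rfl

lemma assoc_comul_comulAntipode (y : H) :
    TensorProduct.assoc k H H H (comul.rTensor H (comulAntipode y)) =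
      comulAntipode.lTensor H (comul (R := k) y) := by
  have h1 : ∀ z : H ⊗[k] H, TensorProduct.assoc k H H H (comul.rTensor H
      ((antipode k).lTensor H z)) =
      ((antipode k).lTensor H).lTensor H (TensorProduct.assoc k H H H (comul.rTensor H z)) := by
    intro z
    induction z using TensorProduct.induction_on with
    | zero => simp
    | add x y hx hy => simp only [map_add, hx, hy]
    | tmul x y =>
      simp only [LinearMap.lTensor_tmul, LinearMap.rTensor_tmul]
      generalize comul (R := k) x = w
      induction w using TensorProduct.induction_on with
      | zero => simp
      | add x y hx hy => simp only [map_add, add_tmul, hx, hy]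
      | tmul a b => simp
  rw [comulAntipode, LinearMap.comp_apply, h1, coassoc_apply, ← LinearMap.lTensor_comp_apply]

/-- If `h` respects the left coactions of `H / I` on `G ⊆ H`, then `sectionMap h` takes values in
`A ⊗ H`, with `A` the algebra of invariants. -/
lemma sectionMap_mem {I : Ideal H} {h : H →ₗ[k] H} {G : Submodule k H}
    (hG : ∀ x ∈ G, (I.restrictScalars k).mkQ.rTensor H (comul (R := k) (h x)) =
      (I.restrictScalars k).mkQ.rTensor H (h.lTensor H (comul x))) {d : H}
    (hd : comul (R := k) d ∈ LinearMap.range (G.subtype.lTensor H)) :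
    sectionMap h d ∈ LinearMap.range
      ((Subalgebra.toSubmodule (coinvariants (k := k) I)).subtype.rTensor H) := by
  rw [toSubmodule_coinvariants, ← ker_rTensor_eq_range, LinearMap.mem_ker]
  apply (TensorProduct.assoc k _ H H).injective
  rw [assoc_coinvariantDefect_rTensor, map_zero, sub_eq_zero]
  let j : H →ₐ[k] H ⊗[k] H := Algebra.TensorProduct.includeLeft
  let α : H ⊗[k] H →ₐ[k] H ⊗[k] (H ⊗[k] H) :=
    (Algebra.TensorProduct.assoc k k k H H H).toAlgHom.comp
      (Algebra.TensorProduct.map (Bialgebra.comulAlgHom k H) (AlgHom.id k H))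
  let β : H ⊗[k] H →ₐ[k] H ⊗[k] (H ⊗[k] H) := Algebra.TensorProduct.includeRight
  let j₁ : H →ₐ[k] H ⊗[k] (H ⊗[k] H) := Algebra.TensorProduct.includeLeft
  let j₂ : H →ₐ[k] H ⊗[k] (H ⊗[k] H) := β.comp j
  have hα : ∀ z : H ⊗[k] H, α z = TensorProduct.assoc k H H H (comul.rTensor H z) := fun z => rfl
  have hαj : toConv j₁.toLinearMap * toConv j₂.toLinearMap = toConv (α.comp j).toLinearMap := by
    apply ofConv_injective
    ext x
    change LinearMap.mul' k _ (TensorProduct.map j₁.toLinearMap j₂.toLinearMap (comul x)) =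
      TensorProduct.assoc k H H H (comul x ⊗ₜ 1)
    generalize comul (R := k) x = w
    induction w using TensorProduct.induction_on with
    | zero => simp
    | add x y hx hy => simp only [map_add, add_tmul, hx, hy]
    | tmul a b => simp [j₁, j₂, β, j]
  -- The map αj ∘ S is the convolution inverse of αj = j₁ * j₂; multiplying by j₁ leaves the inverse
  -- of j₂, which is j₂ ∘ S. In elements: S(d₁)₁d₂ ⊗ S(d₁)₂ = 1 ⊗ S(d).
  have hK : toConv ((α.comp j).toLinearMap ∘ₗ antipode k) * toConv j₁.toLinearMap =
      toConv (j₂.toLinearMap ∘ₗ antipode k) := by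
    rw [← mul_one (_ * toConv j₁.toLinearMap), ← algHom_convMul_antipode j₂, mul_assoc,
      ← mul_assoc (toConv j₁.toLinearMap), hαj, ← mul_assoc, algHom_antipode_convMul, one_mul]
  have hX : toConv j₁.toLinearMap * toConv (β.toLinearMap ∘ₗ comulAntipode ∘ₗ h) =
      toConv ((comulAntipode ∘ₗ h).lTensor H ∘ₗ comul) := by
    apply ofConv_injective
    ext x
    change LinearMap.mul' k _ (TensorProduct.map _ _ (comul x)) = (comulAntipode ∘ₗ h).lTensor H
      (comul x)
    generalize comul (R := k) x = w
    induction w using TensorProduct.induction_on with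
    | zero => simp
    | add x y hx hy => simp only [map_add, hx, hy]
    | tmul a b => simp [j₁, β]
  have hβ : β.toLinearMap ∘ₗ sectionMap h =
      (toConv ((α.comp j).toLinearMap ∘ₗ antipode k) *
        toConv ((comulAntipode ∘ₗ h).lTensor H ∘ₗ comul)).ofConv := by
    rw [← hX, ← mul_assoc, hK]
    exact LinearMap.algHom_comp_convMul_distrib β (toConv (j.toLinearMap ∘ₗ antipode k))
      (toConv (comulAntipode ∘ₗ h))
  have hα' : α.toLinearMap ∘ₗ sectionMap h =
      (toConv ((α.comp j).toLinearMap ∘ₗ antipode k) *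
        toConv (α.toLinearMap ∘ₗ comulAntipode ∘ₗ h)).ofConv :=
    LinearMap.algHom_comp_convMul_distrib α (toConv (j.toLinearMap ∘ₗ antipode k))
      (toConv (comulAntipode ∘ₗ h))
  -- Colinearity of h enters here: modulo I in the first factor, h(y)₁ ⊗ h(y)₂ may be replaced by y₁
  -- ⊗ h(y₂). The factor on the left is harmless since I ⊗ (H ⊗ H) is a left ideal.
  have hdiff : ∀ w : H ⊗[k] G, (I.restrictScalars k).mkQ.rTensor (H ⊗[k] H)
      (LinearMap.mul' k _ (TensorProduct.map ((α.comp j).toLinearMap ∘ₗ antipode k)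
        (α.toLinearMap ∘ₗ comulAntipode ∘ₗ h) (G.subtype.lTensor H w))) =
      (I.restrictScalars k).mkQ.rTensor (H ⊗[k] H)
      (LinearMap.mul' k _ (TensorProduct.map ((α.comp j).toLinearMap ∘ₗ antipode k)
        ((comulAntipode ∘ₗ h).lTensor H ∘ₗ comul) (G.subtype.lTensor H w))) := by
    intro w
    induction w using TensorProduct.induction_on with
    | zero => simp
    | add x y hx hy => simp only [map_add, hx, hy]
    | tmul x y =>
      simp only [LinearMap.lTensor_tmul, TensorProduct.map_tmul, LinearMap.mul'_apply]
      rw [← sub_eq_zero, ← map_sub, ← mul_sub]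
      apply mkQ_rTensor_mul_eq_zero
      have h1 : α (comulAntipode (h y)) = comulAntipode.lTensor H (comul (R := k) (h y)) := by
        rw [hα, assoc_comul_comulAntipode]
      have h2 : ∀ z : H ⊗[k] H, (I.restrictScalars k).mkQ.rTensor (H ⊗[k] H)
          (comulAntipode.lTensor H z) =
          comulAntipode.lTensor _ ((I.restrictScalars k).mkQ.rTensor H z) := by
        intro z
        rw [← LinearMap.comp_apply, ← LinearMap.comp_apply, LinearMap.rTensor_comp_lTensor,
          LinearMap.lTensor_comp_rTensor]
      simp only [LinearMap.coe_comp, Function.comp_apply, AlgHom.toLinearMap_apply,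
        Submodule.subtype_apply, LinearMap.lTensor_comp]
      rw [h1, ← map_sub, h2, map_sub, hG _ y.2, sub_self, map_zero]
  obtain ⟨w, hw⟩ := hd
  have h3 := hdiff w
  rw [hw] at h3
  have h4 : TensorProduct.assoc k H H H (comul.rTensor H (sectionMap h d)) =
      LinearMap.mul' k _ (TensorProduct.map ((α.comp j).toLinearMap ∘ₗ antipode k)
        (α.toLinearMap ∘ₗ comulAntipode ∘ₗ h) (comul d)) := LinearMap.congr_fun hα' d
  have h5 : (1 : H) ⊗ₜ[k] sectionMap h d =
      LinearMap.mul' k _ (TensorProduct.map ((α.comp j).toLinearMap ∘ₗ antipode k)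
        ((comulAntipode ∘ₗ h).lTensor H ∘ₗ comul) (comul d)) := LinearMap.congr_fun hβ d
  rw [h4, h3, ← h5, LinearMap.rTensor_tmul]

/-- Applying id ⊗ ε to the invariance equation gives π(a) = ε(a)π(1), which vanishes for a in A⁺. -/
lemma toFactor_coinvariants_le (I : Ideal H) : toFactor (coinvariants (k := k) I) ≤ I := by
  refine Ideal.span_le.mpr ?_
  rintro a ⟨ha, ha'⟩
  have h1 := congrArg (TensorProduct.rid k _ ∘ counit.lTensor _) (mem_coinvariants.mp ha)
  have h2 : ∀ z : H ⊗[k] H, TensorProduct.rid k _ (counit.lTensor _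
      ((I.restrictScalars k).mkQ.rTensor H z)) =
      (I.restrictScalars k).mkQ (TensorProduct.rid k H (counit.lTensor H z)) := by
    intro z
    induction z using TensorProduct.induction_on with
    | zero => simp
    | add x y hx hy => simp only [map_add, hx, hy]
    | tmul x y => simp
  simp only [Function.comp_apply, h2, lTensor_counit_comul, rid_tmul, one_smul,
    LinearMap.lTensor_tmul, ha', zero_smul] at h1
  exact (Submodule.Quotient.mk_eq_zero _).mp h1

variable {I : Ideal H} [(I.restrictScalars k).IsCoideal]

/-- Local sections of `H → H / I`, regarded as maps from `H` to `H` vanishing on `I`. -/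
lemma HasLocalSections.exists_lift
    (hI : HasLocalSections (Coalgebra.Quotient.mkQCoalgHom (R := k) (I.restrictScalars k)))
    (G : Submodule k H) [FiniteDimensional k G] : ∃ h : H →ₗ[k] H, (∀ x ∈ I, h x = 0) ∧
      (∀ x ∈ G, (I.restrictScalars k).mkQ.rTensor H (comul (R := k) (h x)) =
        (I.restrictScalars k).mkQ.rTensor H (h.lTensor H (comul x))) ∧
      ∀ x ∈ G, counit (R := k) (h x) = counit (R := k) x := by
  obtain ⟨h, hh⟩ := hI (G.map (I.restrictScalars k).mkQ) inferInstance
  refine ⟨h ∘ₗ (I.restrictScalars k).mkQ, fun x hx => ?_, fun x hx => ?_, fun x hx => ?_⟩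
  · rw [LinearMap.comp_apply, show (I.restrictScalars k).mkQ x = 0 from
      (Submodule.Quotient.mk_eq_zero _).mpr hx, map_zero]
  · refine (hh _ (Submodule.mem_map_of_mem hx)).1.trans ?_
    change h.lTensor _ (TensorProduct.map _ _ (comul x)) = _
    rw [← LinearMap.comp_apply, LinearMap.lTensor_comp_map, ← LinearMap.rTensor_comp_lTensor,
      LinearMap.comp_apply]
  · exact (hh _ (Submodule.mem_map_of_mem hx)).2

theorem le_toFactor_coinvariants
    (hI : HasLocalSections (Coalgebra.Quotient.mkQCoalgHom (R := k) (I.restrictScalars k))) :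
    I ≤ toFactor (coinvariants (k := k) I) := by
  intro m hm
  -- Two enlargements: Δ(m) lies in H ⊗ G₀ and Δ(G₀) in H ⊗ G, so that `sectionMap h` is controlled
  -- on the right-hand factors of Δ(m).
  obtain ⟨G₀, hG₀, hmG₀⟩ :=
    exists_finite_submodule_right_of_setFinite {comul (R := k) m} (Set.finite_singleton _)
  obtain ⟨G, hG, hG₀G⟩ := exists_finite_range_le_lTensor (comul (R := k) ∘ₗ G₀.subtype)
  obtain ⟨h, hhI, hhG, hhε⟩ := hI.exists_lift G
  let γ : H →ₗ[k] H := (TensorProduct.rid k H).toLinearMap ∘ₗ counit.lTensor H ∘ₗ sectionMap h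
  have hγ : toConv γ = toConv (antipode k) * toConv h := by
    apply ofConv_injective
    ext x
    change TensorProduct.rid k H (counit.lTensor H (LinearMap.mul' k _
      (TensorProduct.map _ _ (comul x)))) = LinearMap.mul' k H (TensorProduct.map _ _ (comul x))
    generalize comul (R := k) x = w
    induction w using TensorProduct.induction_on with
    | zero => simp
    | add x y hx hy => simp only [map_add, hx, hy]
    | tmul a b => exact rid_counit_comulAntipode _ _
  have hγA : ∀ x ∈ G₀, γ x ∈ coinvariants (k := k) I := by
    intro x hx
    obtain ⟨w, hw⟩ := sectionMap_mem hhG (hG₀G ⟨x, hx⟩)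
    simp only [Submodule.subtype_apply] at hw
    change TensorProduct.rid k H (counit.lTensor H (sectionMap h x)) ∈
      Subalgebra.toSubmodule (coinvariants (k := k) I)
    rw [← hw]
    clear hw
    induction w using TensorProduct.induction_on with
    | zero => simp
    | add x y hx hy => simp only [map_add]; exact Submodule.add_mem _ hx hy
    | tmul a b => simpa using Submodule.smul_mem _ _ a.2
  have hγε : ∀ x ∈ G₀, counit (R := k) (γ x) = counit (R := k) x := by
    intro x hx
    have h1 : LinearMap.mul' k H (sectionMap h x) = antipode k x :=
      mul'_sectionMap hhε (hG₀G ⟨x, hx⟩)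
    have h2 : ∀ z : H ⊗[k] H, counit (R := k) (TensorProduct.rid k H (counit.lTensor H z)) =
        counit (R := k) (LinearMap.mul' k H z) := by
      intro z
      induction z using TensorProduct.induction_on with
      | zero => simp
      | add x y hx hy => simp only [map_add, hx, hy]
      | tmul x y => simp [mul_comm]
    refine (h2 _).trans ?_
    rw [h1, counit_antipode]
  -- Since γ = S * h, convolution with the identity returns h, and h(m) = 0 as m lies in I.
  have hconv : LinearMap.mul' k H (γ.lTensor H (comul m)) = 0 := by
    have h1 : toConv (LinearMap.id : H →ₗ[k] H) * toConv γ = toConv h := by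
      rw [hγ, ← mul_assoc, LinearMap.id_mul_antipode, one_mul]
    have h2 := LinearMap.congr_fun (toConv_injective h1) m
    exact h2.trans (hhI m hm)
  obtain ⟨w, hw⟩ := hmG₀ rfl
  have key : ∀ w : H ⊗[k] G₀, TensorProduct.rid k H (counit.lTensor H (G₀.subtype.lTensor H w)) -
      LinearMap.mul' k H (γ.lTensor H (G₀.subtype.lTensor H w)) ∈
        toFactor (coinvariants (k := k) I) := by
    intro w
    induction w using TensorProduct.induction_on with
    | zero => simp
    | add x y hx hy =>
      simp only [map_add, add_sub_add_comm]
      exact Ideal.add_mem _ hx hy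
    | tmul x y =>
      simp only [LinearMap.lTensor_tmul, Submodule.subtype_apply, rid_tmul, LinearMap.mul'_apply]
      have : counit (R := k) (y : H) • x - x * γ y =
          x * (counit (R := k) (y : H) • 1 - γ y) := by
        rw [mul_sub, mul_smul_comm, mul_one]
      rw [this]
      refine Ideal.mul_mem_left _ _ (Ideal.subset_span ⟨?_, ?_⟩)
      · exact Subalgebra.sub_mem _ (Subalgebra.smul_mem _ (Subalgebra.one_mem _) _) (hγA _ y.2)
      · simp [hγε _ y.2]
  have h3 := key w
  rwa [hw, hconv, lTensor_counit_comul, rid_tmul, one_smul, sub_zero] at h3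

theorem toFactor_coinvariants
    (hI : HasLocalSections (Coalgebra.Quotient.mkQCoalgHom (R := k) (I.restrictScalars k))) :
    toFactor (coinvariants (k := k) I) = I :=
  le_antisymm (toFactor_coinvariants_le I) (le_toFactor_coinvariants hI)

/-- The required local section of A ⊗ H → H is n ↦ `sectionMap h` (S⁻¹(n)). Bijectivity of S both
inverts the product S(d) and turns left multiplication by a into right multiplication by S⁻¹(a). -/
theorem isLeftFlat_coinvariants (hS : Function.Bijective (antipode k : H →ₗ[k] H))
    (hI : HasLocalSections (Coalgebra.Quotient.mkQCoalgHom (R := k) (I.restrictScalars k))) :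
    IsLeftFlat k (coinvariants (k := k) I) H := by
  set A := coinvariants (k := k) I with hA
  apply isLeftFlat_of_local_sections
  intro G₀ hG₀
  obtain ⟨G, hG, hG₀G⟩ := exists_finite_range_le_lTensor
    (comul (R := k) ∘ₗ antipodeInv hS ∘ₗ G₀.subtype)
  obtain ⟨h, hhI, hhG, hhε⟩ := hI.exists_lift G
  let i : A →ₗ[k] H := A.val.toLinearMap
  have hi : Function.Injective i := Subtype.val_injective
  have hiH : Function.Injective (i.rTensor H) :=
    Module.Flat.rTensor_preserves_injective_linearMap _ hi
  obtain ⟨p, hp⟩ := i.exists_leftInverse_of_injective (LinearMap.ker_eq_bot.mpr hi)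
  -- The retraction `p` of A → H makes δ defined on all of H; on `G₀` the values of `sectionMap`
  -- already lie in A ⊗ H and are unchanged.
  let δ : H →ₗ[k] A ⊗[k] H := p.rTensor H ∘ₗ sectionMap h ∘ₗ antipodeInv hS
  have hδ : ∀ n ∈ G₀, i.rTensor H (δ n) = sectionMap h (antipodeInv hS n) := by
    intro n hn
    obtain ⟨w, hw⟩ := sectionMap_mem hhG (hG₀G ⟨n, hn⟩)
    have hw' : i.rTensor H w = sectionMap h (antipodeInv hS n) := hw
    simp only [δ, LinearMap.coe_comp, Function.comp_apply]
    rw [← hw', ← LinearMap.rTensor_comp_apply _ p i, hp, LinearMap.rTensor_id, LinearMap.id_apply]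
  refine ⟨δ, fun n hn => ?_, fun a n hn han => ?_⟩
  · have h1 : ∀ w : A ⊗[k] H, TensorProduct.lift (Algebra.lsmul k k H).toLinearMap w =
        LinearMap.mul' k H (i.rTensor H w) := by
      intro w
      induction w using TensorProduct.induction_on with
      | zero => simp
      | add x y hx hy => simp only [map_add, hx, hy]
      | tmul x y => rfl
    rw [h1, hδ n hn]
    refine (mul'_sectionMap hhε (hG₀G ⟨n, hn⟩)).trans ?_
    exact antipode_antipodeInv hS n
  · apply hiH
    have h1 : ∀ w : A ⊗[k] H, i.rTensor H (a • w) = ((a : H) ⊗ₜ 1) * i.rTensor H w := by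
      intro w
      induction w using TensorProduct.induction_on with
      | zero => simp
      | add x y hx hy => simp only [map_add, smul_add, mul_add, hx, hy]
      | tmul x y => simp [smul_tmul', i]
    rw [h1, hδ n hn, hδ _ han]
    change sectionMap h (antipodeInv hS ((a : H) * n)) = _
    rw [antipodeInv_mul]
    exact sectionMap_mul_antipodeInv hS (isRightCoideal_coinvariants I)
      (fun x hx => hhI x (toFactor_coinvariants_le I hx)) _ a.2

end Section

/-! ### Exchanging left and right -/

section Flip

variable {k : Type*} {A A' M M' N N' : Type*} [CommRing k] [Ring A] [Ring A']
  [AddCommGroup M] [Module k M] [Module A'ᵐᵒᵖ M] [AddCommGroup M'] [Module k M'] [Module A M']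
  [AddCommGroup N] [Module k N] [Module A' N] [AddCommGroup N'] [Module k N'] [Module Aᵐᵒᵖ N']

/-- Exchanging the two factors of `M ⊗ N` respects balancedness over opposite algebras. -/
lemma comm_map_mem_balancedRel (θ : A' → A) (φ : M →ₗ[k] M') (ψ : N →ₗ[k] N')
    (hφ : ∀ (a : A') m, φ (MulOpposite.op a • m) = θ a • φ m)
    (hψ : ∀ (a : A') n, ψ (a • n) = MulOpposite.op (θ a) • ψ n) {z : M ⊗[k] N}
    (hz : z ∈ balancedRel k A' M N) :
    TensorProduct.comm k M' N' (TensorProduct.map φ ψ z) ∈ balancedRel k A N' M' := by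
  induction hz using Submodule.span_induction with
  | mem x hx =>
    obtain ⟨m, a, n, rfl⟩ := hx
    rw [map_sub, map_sub, map_tmul, map_tmul, comm_tmul, comm_tmul, hφ, hψ, ← neg_sub]
    exact Submodule.neg_mem _ (Submodule.subset_span ⟨ψ n, θ a, φ m, rfl⟩)
  | zero => simp
  | add x y _ _ hx hy => rw [map_add, map_add]; exact Submodule.add_mem _ hx hy
  | smul a x _ hx => rw [map_smul, map_smul]; exact Submodule.smul_mem _ _ hx

end Flip

section Opposite

variable {k : Type u} {H H' : Type v} [Field k] [Ring H] [HopfAlgebra k H] [Ring H']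
  [HopfAlgebra k H']

/-- The bialgebra `H'` is identified with `H` with the opposite multiplication. -/
structure IsOppositeEquiv (e : H ≃ₗ[k] H') : Prop where
  map_mul : ∀ x y, e (x * y) = e y * e x
  map_comul : ∀ x, comul (R := k) (e x) = TensorProduct.map e.toLinearMap e.toLinearMap (comul x)
  map_counit : ∀ x, counit (R := k) (e x) = counit (R := k) x

namespace IsOppositeEquiv

variable {e : H ≃ₗ[k] H'} (he : IsOppositeEquiv e)

include he

lemma map_one : e 1 = 1 := by
  have h := he.map_mul (e.symm 1) 1
  rwa [mul_one, e.apply_symm_apply, mul_one, eq_comm] at h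

lemma symm : IsOppositeEquiv e.symm where
  map_mul x y := by
    apply e.injective
    rw [he.map_mul]
    simp
  map_comul x := by
    have h := he.map_comul (e.symm x)
    rw [e.apply_symm_apply] at h
    rw [h, ← LinearMap.comp_apply, ← TensorProduct.map_comp]
    simp
  map_counit x := by
    rw [← he.map_counit, e.apply_symm_apply]

/-- The subalgebra of `H'` corresponding to a subalgebra of `H`. -/
def subalgebra (A : Subalgebra k H) : Subalgebra k H' where
  carrier := {x | e.symm x ∈ A}
  mul_mem' {a b} ha hb := by
    change e.symm (a * b) ∈ A
    rw [he.symm.map_mul]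
    exact A.mul_mem hb ha
  add_mem' {a b} ha hb := by
    change e.symm (a + b) ∈ A
    rw [map_add]
    exact A.add_mem ha hb
  algebraMap_mem' r := by
    change e.symm _ ∈ A
    rw [Algebra.algebraMap_eq_smul_one, map_smul, he.symm.map_one]
    exact A.smul_mem A.one_mem r

lemma mem_subalgebra {A : Subalgebra k H} {x : H'} : x ∈ he.subalgebra A ↔ e.symm x ∈ A := Iff.rfl

lemma apply_mem_subalgebra {A : Subalgebra k H} {x : H} : e x ∈ he.subalgebra A ↔ x ∈ A := by
  rw [mem_subalgebra, e.symm_apply_apply]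

lemma symm_subalgebra_subalgebra (A : Subalgebra k H) :
    he.symm.subalgebra (he.subalgebra A) = A := by
  ext x
  rw [mem_subalgebra]
  exact he.apply_mem_subalgebra

lemma isRightCoideal_subalgebra {A : Subalgebra k H} (hA : IsRightCoideal A) :
    IsRightCoideal (he.subalgebra A) := by
  intro a ha
  obtain ⟨w, hw⟩ := hA _ ha
  have h := he.map_comul (e.symm a)
  rw [e.apply_symm_apply, ← hw] at h
  rw [h]
  clear h hw
  induction w using TensorProduct.induction_on with
  | zero => simp
  | add x y hx hy => rw [map_add, map_add]; exact Submodule.add_mem _ hx hy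
  | tmul x y => exact ⟨⟨e x, he.apply_mem_subalgebra.mpr x.2⟩ ⊗ₜ e y, by simp⟩

lemma balancedTmul_eq {A : Subalgebra k H} {h : H}
    (hh : balancedTmul k A h (1 : H) = balancedTmul k A (1 : H) h) :
    balancedTmul k (he.subalgebra A) (e h) (1 : H') =
      balancedTmul k (he.subalgebra A) (1 : H') (e h) := by
  have h1 := (Submodule.Quotient.eq _).mp hh
  have h2 := comm_map_mem_balancedRel (A := he.subalgebra A)
    (fun a : A => ⟨e a, he.apply_mem_subalgebra.mpr a.2⟩)
    e.toLinearMap e.toLinearMap (fun a m => he.map_mul m (a : H)) (fun a n => he.map_mul (a : H) n) h1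
  rw [map_sub, map_sub, map_tmul, map_tmul, comm_tmul, comm_tmul, LinearEquiv.coe_coe,
    he.map_one] at h2
  exact ((Submodule.Quotient.eq _).mpr h2).symm

lemma isDominion_subalgebra {A : Subalgebra k H} (hA : IsDominion A) :
    IsDominion (he.subalgebra A) := by
  rw [IsDominion, Set.ext_iff] at hA ⊢
  intro x
  refine Iff.trans (hA (e.symm x)) ⟨fun h => ?_, fun h => ?_⟩
  · simpa using he.balancedTmul_eq h
  · have := he.symm.balancedTmul_eq h
    rwa [he.symm_subalgebra_subalgebra] at this

/-- The right action of the subalgebra of `H'` is the left action of the one of `H`. -/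
def opRingEquiv (A : Subalgebra k H) : A ≃+* (he.subalgebra A)ᵐᵒᵖ where
  toFun a := MulOpposite.op ⟨e a, he.apply_mem_subalgebra.mpr a.2⟩
  invFun x := ⟨e.symm x.unop, x.unop.2⟩
  left_inv a := by simp
  right_inv x := by simp
  map_mul' a b := MulOpposite.unop_injective (Subtype.ext (he.map_mul a b))
  map_add' a b := MulOpposite.unop_injective (Subtype.ext (map_add e (a : H) b))

/-- Right modules over the opposite of A are left A-modules via `opRingEquiv`; exchanging tensor
factors turns one flatness test into the other. -/
lemma isLeftFlat_subalgebra {A : Subalgebra k H} (hA : IsRightFlat k A H) :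
    IsLeftFlat k (he.subalgebra A) H' := by
  intro M M' _ _ _ _ _ _ _ _ f hf
  let _ : Module A M := Module.compHom M (he.opRingEquiv A).toRingHom
  let _ : Module A M' := Module.compHom M' (he.opRingEquiv A).toRingHom
  have hsmul : ∀ (c : k) (a : A), he.opRingEquiv A (c • a) = c • he.opRingEquiv A a := fun c a =>
    MulOpposite.unop_injective (Subtype.ext (map_smul e c (a : H)))
  have _ : IsScalarTower k A M :=
    ⟨fun c a m => by
      change he.opRingEquiv A (c • a) • m = c • he.opRingEquiv A a • m
      rw [hsmul, smul_assoc]⟩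
  have _ : IsScalarTower k A M' :=
    ⟨fun c a m => by
      change he.opRingEquiv A (c • a) • m = c • he.opRingEquiv A a • m
      rw [hsmul, smul_assoc]⟩
  let f' : M →ₗ[A] M' := { f with map_smul' := fun a m => f.map_smul (he.opRingEquiv A a) m }
  have hinj := hA M M' f' hf
  rw [← LinearMap.ker_eq_bot, LinearMap.ker_eq_bot'] at hinj ⊢
  intro t ht
  obtain ⟨z, rfl⟩ := Submodule.mkQ_surjective _ t
  have h1 : (f.restrictScalars k).rTensor H' z ∈ balancedRel k (he.subalgebra A) M' H' :=
    (Submodule.Quotient.mk_eq_zero _).mp ht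
  have h2 := comm_map_mem_balancedRel (A := A)
    (fun a : he.subalgebra A => (he.opRingEquiv A).symm (MulOpposite.op a))
    LinearMap.id e.symm.toLinearMap
    (fun a m => by
      change _ = he.opRingEquiv A _ • m
      rw [RingEquiv.apply_symm_apply]
      rfl)
    (fun a n => he.symm.map_mul (a : H') n) h1
  have h3 : ∀ z : M ⊗[k] H', TensorProduct.comm k M' H (TensorProduct.map LinearMap.id
      e.symm.toLinearMap ((f.restrictScalars k).rTensor H' z)) =
      (f'.restrictScalars k).lTensor H (TensorProduct.comm k M H
        (TensorProduct.map LinearMap.id e.symm.toLinearMap z)) := by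
    intro z
    induction z using TensorProduct.induction_on with
    | zero => simp
    | add x y hx hy => simp only [map_add, hx, hy]
    | tmul x y =>
      simp only [LinearMap.lTensor_tmul, LinearMap.rTensor_tmul, map_tmul, comm_tmul]
      rfl
  rw [h3] at h2
  have h4 := (Submodule.Quotient.mk_eq_zero _).mp
    (hinj ((balancedRel k A H M).mkQ _) ((Submodule.Quotient.mk_eq_zero _).mpr h2))
  have h5 := comm_map_mem_balancedRel (A := he.subalgebra A)
    (fun a : A => (he.opRingEquiv A a).unop) e.toLinearMap LinearMap.id
    (fun a m => he.map_mul m (a : H)) (fun a n => rfl) h4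
  refine (Submodule.Quotient.mk_eq_zero _).mpr ?_
  convert h5
  clear h1 h2 h4 h5 ht
  induction z using TensorProduct.induction_on with
  | zero => simp
  | add x y hx hy => simp only [map_add, ← hx, ← hy]
  | tmul x y => simp

lemma isRightFlat_of_subalgebra {A : Subalgebra k H} (hA : IsLeftFlat k (he.subalgebra A) H') :
    IsRightFlat k A H := by
  intro M M' _ _ _ _ _ _ _ _ f hf
  let _ : Module (he.subalgebra A)ᵐᵒᵖ M := Module.compHom M (he.opRingEquiv A).symm.toRingHom
  let _ : Module (he.subalgebra A)ᵐᵒᵖ M' := Module.compHom M' (he.opRingEquiv A).symm.toRingHom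
  have hsmul : ∀ (c : k) a, (he.opRingEquiv A).symm (c • a) = c • (he.opRingEquiv A).symm a :=
    fun c a => Subtype.ext (map_smul e.symm c (a.unop : H'))
  have _ : IsScalarTower k (he.subalgebra A)ᵐᵒᵖ M :=
    ⟨fun c a m => by
      change (he.opRingEquiv A).symm (c • a) • m = c • (he.opRingEquiv A).symm a • m
      rw [hsmul, smul_assoc]⟩
  have _ : IsScalarTower k (he.subalgebra A)ᵐᵒᵖ M' :=
    ⟨fun c a m => by
      change (he.opRingEquiv A).symm (c • a) • m = c • (he.opRingEquiv A).symm a • m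
      rw [hsmul, smul_assoc]⟩
  let f' : M →ₗ[(he.subalgebra A)ᵐᵒᵖ] M' :=
    { f with map_smul' := fun a m => f.map_smul ((he.opRingEquiv A).symm a) m }
  have hinj := hA M M' f' hf
  rw [← LinearMap.ker_eq_bot, LinearMap.ker_eq_bot'] at hinj ⊢
  intro t ht
  obtain ⟨z, rfl⟩ := Submodule.mkQ_surjective _ t
  have h1 : (f.restrictScalars k).lTensor H z ∈ balancedRel k A H M' :=
    (Submodule.Quotient.mk_eq_zero _).mp ht
  have hop : ∀ (a : A) (m : M'), a • m = he.opRingEquiv A a • m := fun a m => by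
    change a • m = (he.opRingEquiv A).symm (he.opRingEquiv A a) • m
    rw [RingEquiv.symm_apply_apply]
  have h2 := comm_map_mem_balancedRel (A := he.subalgebra A)
    (fun a : A => (he.opRingEquiv A a).unop) e.toLinearMap LinearMap.id
    (fun a m => he.map_mul m (a : H)) (fun a n => hop a n) h1
  have h3 : ∀ z : H ⊗[k] M, TensorProduct.comm k H' M' (TensorProduct.map e.toLinearMap
      LinearMap.id ((f.restrictScalars k).lTensor H z)) =
      (f'.restrictScalars k).rTensor H' (TensorProduct.comm k H' M
        (TensorProduct.map e.toLinearMap LinearMap.id z)) := by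
    intro z
    induction z using TensorProduct.induction_on with
    | zero => simp
    | add x y hx hy => simp only [map_add, hx, hy]
    | tmul x y =>
      simp only [LinearMap.lTensor_tmul, LinearMap.rTensor_tmul, map_tmul, comm_tmul]
      rfl
  rw [h3] at h2
  have h4 := (Submodule.Quotient.mk_eq_zero _).mp
    (hinj ((balancedRel k (he.subalgebra A) M H').mkQ _)
      ((Submodule.Quotient.mk_eq_zero _).mpr h2))
  have h5 := comm_map_mem_balancedRel (A := A)
    (fun a : he.subalgebra A => (he.opRingEquiv A).symm (MulOpposite.op a))
    LinearMap.id e.symm.toLinearMap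
    (fun a m => rfl)
    (fun a n => he.symm.map_mul (a : H') n) h4
  refine (Submodule.Quotient.mk_eq_zero _).mpr ?_
  convert h5
  clear h1 h2 h4 h5 ht
  induction z using TensorProduct.induction_on with
  | zero => simp
  | add x y hx hy => simp only [map_add, ← hx, ← hy]
  | tmul x y => simp

lemma subalgebra_mem_leftFlatDominions_iff {A : Subalgebra k H} :
    he.subalgebra A ∈ leftFlatDominions k H' ↔ A ∈ rightFlatDominions k H := by
  refine ⟨fun ⟨h1, h2, h3⟩ => ⟨?_, ?_, he.isRightFlat_of_subalgebra h3⟩, fun ⟨h1, h2, h3⟩ =>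
    ⟨he.isRightCoideal_subalgebra h1, he.isDominion_subalgebra h2, he.isLeftFlat_subalgebra h3⟩⟩
  · rw [← he.symm_subalgebra_subalgebra A]
    exact he.symm.isRightCoideal_subalgebra h1
  · rw [← he.symm_subalgebra_subalgebra A]
    exact he.symm.isDominion_subalgebra h2

end IsOppositeEquiv

end Opposite

/-! ### Comodules over the co-opposite coalgebra -/

section Coop

variable {k : Type u} [Field k] {C C' : Type*} [AddCommGroup C] [Module k C] [Coalgebra k C]
  [AddCommGroup C'] [Module k C'] [Coalgebra k C']

/-- `c : C → C'` is a coalgebra map from the co-opposite coalgebra of `C`. -/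
structure IsAntiCoalgHom (c : C →ₗ[k] C') : Prop where
  map_comul : ∀ x, comul (R := k) (c x) = TensorProduct.comm k C' C' (TensorProduct.map c c (comul x))
  map_counit : ∀ x, counit (R := k) (c x) = counit (R := k) x

lemma IsAntiCoalgHom.symm {c : C ≃ₗ[k] C'} (hc : IsAntiCoalgHom c.toLinearMap) :
    IsAntiCoalgHom c.symm.toLinearMap where
  map_comul x := by
    have h := hc.map_comul (c.symm x)
    rw [LinearEquiv.coe_coe, c.apply_symm_apply] at h
    rw [h]
    generalize comul (R := k) (c.symm x) = z
    induction z using TensorProduct.induction_on with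
    | zero => simp
    | add x y hx hy => rw [map_add, map_add, map_add, map_add, ← hx, ← hy]
    | tmul x y => simp
  map_counit x := by
    have h := hc.map_counit (c.symm x)
    rw [LinearEquiv.coe_coe, c.apply_symm_apply] at h
    exact h.symm

variable {V : Type*} [AddCommGroup V] [Module k V]

lemma IsAntiCoalgHom.isLeftCoaction {c : C →ₗ[k] C'} (hc : IsAntiCoalgHom c)
    {ρ : V →ₗ[k] V ⊗[k] C} (hρ : IsRightCoaction ρ) :
    IsLeftCoaction (c.rTensor V ∘ₗ (TensorProduct.comm k V C).toLinearMap ∘ₗ ρ) where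
  coassoc := by
    let Φ : V ⊗[k] (C ⊗[k] C) →ₗ[k] C' ⊗[k] (C' ⊗[k] V) :=
      (TensorProduct.assoc k C' C' V).toLinearMap ∘ₗ
        ((TensorProduct.comm k C' C').toLinearMap ∘ₗ TensorProduct.map c c).rTensor V ∘ₗ
          (TensorProduct.comm k V (C ⊗[k] C)).toLinearMap
    have h1 : ∀ t : V ⊗[k] C, TensorProduct.assoc k C' C' V
        ((comul (R := k) (A := C')).rTensor V (c.rTensor V (TensorProduct.comm k V C t))) =
        Φ ((comul (R := k) (A := C)).lTensor V t) := by
      intro t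
      induction t using TensorProduct.induction_on with
      | zero => simp
      | add x y hx hy => simp only [map_add, hx, hy]
      | tmul v d => simp [Φ, hc.map_comul]
    have h2 : ∀ t : V ⊗[k] C, (c.rTensor V ∘ₗ (TensorProduct.comm k V C).toLinearMap ∘ₗ ρ).lTensor C'
        (c.rTensor V (TensorProduct.comm k V C t)) =
        Φ (TensorProduct.assoc k V C C (ρ.rTensor C t)) := by
      intro t
      induction t using TensorProduct.induction_on with
      | zero => simp
      | add x y hx hy => simp only [map_add, hx, hy]
      | tmul v d =>
        simp only [LinearMap.rTensor_tmul, comm_tmul, LinearMap.lTensor_tmul, LinearMap.comp_apply,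
          LinearEquiv.coe_coe]
        generalize ρ v = z
        induction z using TensorProduct.induction_on with
        | zero => simp
        | add x y hx hy => simp only [map_add, tmul_add, add_tmul, hx, hy]
        | tmul v d => simp [Φ]
    ext x
    have h := LinearMap.congr_fun hρ.coassoc x
    simp only [LinearMap.comp_apply, LinearEquiv.coe_coe] at h
    simp only [LinearMap.comp_apply, LinearEquiv.coe_coe]
    rw [h1, ← h, ← h2]
  counit := by
    have h1 : ∀ t : V ⊗[k] C, (counit (R := k) (A := C')).rTensor V
        (c.rTensor V (TensorProduct.comm k V C t)) = TensorProduct.comm k V k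
        ((counit (R := k) (A := C)).lTensor V t) := by
      intro t
      induction t using TensorProduct.induction_on with
      | zero => simp
      | add x y hx hy => simp only [map_add, hx, hy]
      | tmul v d => simp [hc.map_counit]
    ext x
    have h := LinearMap.congr_fun hρ.counit x
    simp only [LinearMap.comp_apply, LinearEquiv.coe_coe] at h ⊢
    rw [h1, h]
    simp

lemma IsAntiCoalgHom.isRightCoaction {c : C →ₗ[k] C'} (hc : IsAntiCoalgHom c)
    {ρ : V →ₗ[k] C ⊗[k] V} (hρ : IsLeftCoaction ρ) :
    IsRightCoaction (c.lTensor V ∘ₗ (TensorProduct.comm k C V).toLinearMap ∘ₗ ρ) where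
  coassoc := by
    let Φ : C ⊗[k] (C ⊗[k] V) →ₗ[k] V ⊗[k] (C' ⊗[k] C') :=
      ((TensorProduct.comm k C' C').toLinearMap ∘ₗ TensorProduct.map c c).lTensor V ∘ₗ
          (TensorProduct.comm k (C ⊗[k] C) V).toLinearMap ∘ₗ
            (TensorProduct.assoc k C C V).symm.toLinearMap
    have h1 : ∀ t : C ⊗[k] V, (comul (R := k) (A := C')).lTensor V
        (c.lTensor V (TensorProduct.comm k C V t)) =
        Φ (TensorProduct.assoc k C C V ((comul (R := k) (A := C)).rTensor V t)) := by
      intro t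
      induction t using TensorProduct.induction_on with
      | zero => simp
      | add x y hx hy => simp only [map_add, hx, hy]
      | tmul v d => simp [Φ, hc.map_comul]
    have h2 : ∀ t : C ⊗[k] V, TensorProduct.assoc k V C' C'
        ((c.lTensor V ∘ₗ (TensorProduct.comm k C V).toLinearMap ∘ₗ ρ).rTensor C'
          (c.lTensor V (TensorProduct.comm k C V t))) = Φ (ρ.lTensor C t) := by
      intro t
      induction t using TensorProduct.induction_on with
      | zero => simp
      | add x y hx hy => simp only [map_add, hx, hy]
      | tmul d v =>
        simp only [LinearMap.rTensor_tmul, comm_tmul, LinearMap.lTensor_tmul, LinearMap.comp_apply,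
          LinearEquiv.coe_coe]
        generalize ρ v = z
        induction z using TensorProduct.induction_on with
        | zero => simp
        | add x y hx hy => simp only [map_add, tmul_add, add_tmul, hx, hy]
        | tmul v d => simp [Φ]
    ext x
    have h := LinearMap.congr_fun hρ.coassoc x
    simp only [LinearMap.comp_apply, LinearEquiv.coe_coe] at h
    simp only [LinearMap.comp_apply, LinearEquiv.coe_coe]
    rw [h1, h, ← h2]
  counit := by
    have h1 : ∀ t : C ⊗[k] V, (counit (R := k) (A := C')).lTensor V
        (c.lTensor V (TensorProduct.comm k C V t)) = TensorProduct.comm k k V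
        ((counit (R := k) (A := C)).rTensor V t) := by
      intro t
      induction t using TensorProduct.induction_on with
      | zero => simp
      | add x y hx hy => simp only [map_add, hx, hy]
      | tmul v d => simp [hc.map_counit]
    ext x
    have h := LinearMap.congr_fun hρ.counit x
    simp only [LinearMap.comp_apply, LinearEquiv.coe_coe] at h ⊢
    rw [h1, h]
    simp

end Coop

section CoopEmbed

variable {k : Type u} [Field k] {C C' D D' : Type v}
  [AddCommGroup C] [Module k C] [Coalgebra k C] [AddCommGroup C'] [Module k C'] [Coalgebra k C']
  [AddCommGroup D] [Module k D] [Coalgebra k D] [AddCommGroup D'] [Module k D'] [Coalgebra k D']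

/-- A left C'-comodule is read as a right C-comodule through c⁻¹, embedded there, and the ambient
D-comodule is carried back through s. -/
lemma RightComodulesEmbed.leftComodulesEmbed {π : D →ₗc[k] C} {π' : D' →ₗc[k] C'}
    {s : D ≃ₗ[k] D'} {c : C ≃ₗ[k] C'} (hs : IsAntiCoalgHom s.toLinearMap)
    (hc : IsAntiCoalgHom c.toLinearMap) (h : ∀ x, c (π x) = π' (s x))
    (hπ : RightComodulesEmbed π) : LeftComodulesEmbed π' := by
  intro V _ _ _ ρ hρ
  obtain ⟨W, _, _, τ, j, hτ, hj, hjτ⟩ := hπ V _ (hc.symm.isRightCoaction hρ)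
  refine ⟨W, _, _, _, j, hs.isLeftCoaction hτ, hj, LinearMap.ext fun x => ?_⟩
  have h1 : ∀ t : W ⊗[k] D, π'.toLinearMap.rTensor W (s.toLinearMap.rTensor W
      (TensorProduct.comm k W D t)) = c.toLinearMap.rTensor W
        (TensorProduct.comm k W C (π.toLinearMap.lTensor W t)) := by
    intro t
    induction t using TensorProduct.induction_on with
    | zero => simp
    | add x y hx hy => simp only [map_add, hx, hy]
    | tmul v d => simp [h]
  have h2 : ∀ t : C' ⊗[k] V, c.toLinearMap.rTensor W (TensorProduct.comm k W C (j.rTensor C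
      (c.symm.toLinearMap.lTensor V (TensorProduct.comm k C' V t)))) = j.lTensor C' t := by
    intro t
    induction t using TensorProduct.induction_on with
    | zero => simp
    | add x y hx hy => simp only [map_add, hx, hy]
    | tmul v d => simp
  have h3 := LinearMap.congr_fun hjτ x
  simp only [LinearMap.comp_apply, LinearEquiv.coe_coe] at h3 ⊢
  rw [h1, h3, h2]

lemma LeftComodulesEmbed.rightComodulesEmbed {π : D →ₗc[k] C} {π' : D' →ₗc[k] C'}
    {s : D ≃ₗ[k] D'} {c : C ≃ₗ[k] C'} (hs : IsAntiCoalgHom s.toLinearMap)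
    (hc : IsAntiCoalgHom c.toLinearMap) (h : ∀ x, c (π x) = π' (s x))
    (hπ : LeftComodulesEmbed π) : RightComodulesEmbed π' := by
  intro V _ _ _ ρ hρ
  obtain ⟨W, _, _, τ, j, hτ, hj, hjτ⟩ := hπ V _ (hc.symm.isLeftCoaction hρ)
  refine ⟨W, _, _, _, j, hs.isRightCoaction hτ, hj, LinearMap.ext fun x => ?_⟩
  have h1 : ∀ t : D ⊗[k] W, π'.toLinearMap.lTensor W (s.toLinearMap.lTensor W
      (TensorProduct.comm k D W t)) = c.toLinearMap.lTensor W
        (TensorProduct.comm k C W (π.toLinearMap.rTensor W t)) := by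
    intro t
    induction t using TensorProduct.induction_on with
    | zero => simp
    | add x y hx hy => simp only [map_add, hx, hy]
    | tmul v d => simp [h]
  have h2 : ∀ t : V ⊗[k] C', c.toLinearMap.lTensor W (TensorProduct.comm k C W (j.lTensor C
      (c.symm.toLinearMap.rTensor V (TensorProduct.comm k V C' t)))) = j.rTensor C' t := by
    intro t
    induction t using TensorProduct.induction_on with
    | zero => simp
    | add x y hx hy => simp only [map_add, hx, hy]
    | tmul v d => simp
  have h3 := LinearMap.congr_fun hjτ x
  simp only [LinearMap.comp_apply, LinearEquiv.coe_coe] at h3 ⊢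
  rw [h1, h3, h2]

end CoopEmbed

/-! ### Transport of factor coalgebras along an algebra isomorphism reversing comultiplication -/

section Ideal

variable {k : Type u} {H H' : Type v} [Field k] [Ring H] [HopfAlgebra k H] [Ring H']
  [HopfAlgebra k H']

lemma isCoideal_comap_symm {s : H ≃ₐ[k] H'} (hs : IsAntiCoalgHom s.toLinearEquiv.toLinearMap)
    (I : Ideal H) [hI : (I.restrictScalars k).IsCoideal] :
    ((I.comap s.symm).restrictScalars k).IsCoideal where
  counit_eq_zero x hx := by
    have h := hI.counit_eq_zero (x := s.symm x) hx
    rwa [← hs.map_counit, LinearEquiv.coe_coe, AlgEquiv.toLinearEquiv_apply,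
      s.apply_symm_apply] at h
  map_mkQ_comul_eq_zero x hx := by
    have h := hI.map_mkQ_comul_eq_zero (x := s.symm x) hx
    have h1 := hs.map_comul (s.symm x)
    rw [LinearEquiv.coe_coe, AlgEquiv.toLinearEquiv_apply, s.apply_symm_apply] at h1
    have hle : I.restrictScalars k ≤ ((I.comap s.symm).restrictScalars k).comap
        s.toLinearEquiv.toLinearMap := fun y hy => by
      change s.symm (s y) ∈ I
      rwa [s.symm_apply_apply]
    have h2 : ∀ z : H ⊗[k] H, TensorProduct.map ((I.comap s.symm).restrictScalars k).mkQ
        ((I.comap s.symm).restrictScalars k).mkQ (TensorProduct.comm k H' H'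
          (TensorProduct.map s.toLinearEquiv.toLinearMap s.toLinearEquiv.toLinearMap z)) =
        TensorProduct.comm k _ _ (TensorProduct.map (Submodule.mapQ _ _ _ hle)
          (Submodule.mapQ _ _ _ hle) (TensorProduct.map (I.restrictScalars k).mkQ
            (I.restrictScalars k).mkQ z)) := by
      intro z
      induction z using TensorProduct.induction_on with
      | zero => simp
      | add x y hx hy => simp only [map_add, hx, hy]
      | tmul x y => simp
    rw [h1, h2, h, map_zero, map_zero]

lemma map_restrictScalars_eq (s : H ≃ₐ[k] H') (I : Ideal H) :
    (I.restrictScalars k).map s.toLinearEquiv.toLinearMap = (I.comap s.symm).restrictScalars k := by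
  ext y
  refine ⟨?_, fun hy => ⟨s.symm y, hy, by simp⟩⟩
  rintro ⟨x, hx, rfl⟩
  change s.symm (s x) ∈ I
  rwa [s.symm_apply_apply]

/-- The isomorphism of factor spaces induced by an isomorphism of algebras. -/
def factorEquiv (s : H ≃ₐ[k] H') (I : Ideal H) :
    (H ⧸ I.restrictScalars k) ≃ₗ[k] (H' ⧸ (I.comap s.symm).restrictScalars k) :=
  Submodule.Quotient.equiv _ _ s.toLinearEquiv (map_restrictScalars_eq s I)

lemma factorEquiv_mkQ (s : H ≃ₐ[k] H') (I : Ideal H) (x : H) :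
    factorEquiv s I ((I.restrictScalars k).mkQ x) =
      ((I.comap s.symm).restrictScalars k).mkQ (s x) := rfl

lemma isAntiCoalgHom_factorEquiv {s : H ≃ₐ[k] H'}
    (hs : IsAntiCoalgHom s.toLinearEquiv.toLinearMap) (I : Ideal H)
    [(I.restrictScalars k).IsCoideal] [((I.comap s.symm).restrictScalars k).IsCoideal] :
    IsAntiCoalgHom (factorEquiv s I).toLinearMap where
  map_comul x := by
    obtain ⟨x, rfl⟩ := Submodule.mkQ_surjective _ x
    rw [LinearEquiv.coe_coe, factorEquiv_mkQ]
    change TensorProduct.map ((I.comap s.symm).restrictScalars k).mkQ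
      ((I.comap s.symm).restrictScalars k).mkQ (comul (s.toLinearEquiv.toLinearMap x)) =
      TensorProduct.comm k _ _ (TensorProduct.map (factorEquiv s I).toLinearMap
        (factorEquiv s I).toLinearMap (TensorProduct.map (I.restrictScalars k).mkQ
            (I.restrictScalars k).mkQ (comul x)))
    rw [hs.map_comul]
    generalize comul (R := k) x = z
    induction z using TensorProduct.induction_on with
    | zero => simp
    | add x y hx hy => simp only [map_add, hx, hy]
    | tmul x y => rfl
  map_counit x := by
    obtain ⟨x, rfl⟩ := Submodule.mkQ_surjective _ x
    exact hs.map_counit x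

theorem comap_symm_mem_leftEmbeddingFactors_iff {s : H ≃ₐ[k] H'}
    (hs : IsAntiCoalgHom s.toLinearEquiv.toLinearMap) {I : Ideal H} :
    I.comap s.symm ∈ leftEmbeddingFactors k H' ↔ I ∈ rightEmbeddingFactors k H := by
  constructor
  · rintro ⟨hI', h⟩
    have hI : (I.restrictScalars k).IsCoideal := by
      have hs' : IsAntiCoalgHom s.symm.toLinearEquiv.toLinearMap := hs.symm
      have := isCoideal_comap_symm hs' (I.comap s.symm)
      convert this
      ext x
      simp
    exact ⟨hI, h.rightComodulesEmbed hs.symm (isAntiCoalgHom_factorEquiv hs I).symm fun x => by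
      rw [LinearEquiv.symm_apply_eq]
      change _ = ((I.comap s.symm).restrictScalars k).mkQ (s (s.symm x))
      rw [s.apply_symm_apply]
      rfl⟩
  · rintro ⟨hI, h⟩
    have hI' := isCoideal_comap_symm hs I
    exact ⟨hI', h.leftComodulesEmbed hs (isAntiCoalgHom_factorEquiv hs I) fun x => rfl⟩

end Ideal

/-! ### The correspondence -/

section Opposite

variable {k : Type u} {H H' : Type v} [Field k] [Ring H] [HopfAlgebra k H] [Ring H']
  [HopfAlgebra k H'] {e : H ≃ₗ[k] H'} (he : IsOppositeEquiv e)
  (hS : Function.Bijective (antipode k : H →ₗ[k] H))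

namespace IsOppositeEquiv

/-- The antipode is an isomorphism of algebras onto the opposite algebra. -/
noncomputable def antipodeEquiv : H ≃ₐ[k] H' :=
  AlgEquiv.ofLinearEquiv ((LinearEquiv.ofBijective (antipode k) hS).trans e)
    (by
      change e (antipode k 1) = 1
      rw [antipode_one, he.map_one])
    (fun x y => by
      change e (antipode k (x * y)) = e (antipode k x) * e (antipode k y)
      rw [antipode_mul_antidistrib, he.map_mul])

lemma isAntiCoalgHom_antipodeEquiv :
    IsAntiCoalgHom (he.antipodeEquiv hS).toLinearEquiv.toLinearMap where
  map_comul x := by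
    change comul (e (antipode k x)) = _
    rw [he.map_comul, comul_antipode]
    generalize comul (R := k) x = z
    induction z using TensorProduct.induction_on with
    | zero => simp
    | add x y hx hy => simp only [map_add, hx, hy]
    | tmul x y => rfl
  map_counit x := by
    change counit (e (antipode k x)) = _
    rw [he.map_counit, counit_antipode]

/-- S carries HA⁺ onto the left ideal of H' generated by A⁺. Both inclusions come from
`mkQ_toFactor_antipodeInv`, used for H and for H'; `hSe` says that the antipode of H' is the inverse
of S, so its own inverse is S. -/
lemma toFactor_subalgebra (hS' : Function.Bijective (antipode k : H' →ₗ[k] H'))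
    (hSe : ∀ x, antipode k (e (antipode k x)) = e x) {A : Subalgebra k H}
    (hA : IsRightCoideal A) :
    toFactor (he.subalgebra A) = (toFactor A).comap (he.antipodeEquiv hS).symm := by
  apply le_antisymm
  · refine Ideal.span_le.mpr fun y ⟨hy, hy0⟩ => ?_
    change (he.antipodeEquiv hS).symm y ∈ toFactor A
    have h := mkQ_toFactor_antipodeInv hS hA hy
    rw [he.symm.map_counit, hy0, zero_smul] at h
    exact (Submodule.Quotient.mk_eq_zero _).mp h
  · intro x hx
    have hle : toFactor A ≤ (toFactor (he.subalgebra A)).comap (he.antipodeEquiv hS) := by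
      refine Ideal.span_le.mpr fun a ⟨ha, ha0⟩ => ?_
      change e (antipode k a) ∈ toFactor (he.subalgebra A)
      have h := mkQ_toFactor_antipodeInv hS' (he.isRightCoideal_subalgebra hA)
        (he.apply_mem_subalgebra.mpr ha)
      rw [he.map_counit, ha0, zero_smul, ← hSe, antipodeInv_antipode] at h
      exact (Submodule.Quotient.mk_eq_zero _).mp h
    have h := hle hx
    rwa [Ideal.mem_comap, AlgEquiv.apply_symm_apply] at h

end IsOppositeEquiv

end Opposite

section OppositeHopf

variable {k : Type u} {H : Type v} [Field k] [Ring H] [HopfAlgebra k H]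

/-- The opposite of a Hopf algebra is a bialgebra. -/
@[reducible]
noncomputable def opBialgebra (k : Type u) (H : Type v) [Field k] [Ring H] [HopfAlgebra k H] :
    Bialgebra k Hᵐᵒᵖ :=
  Bialgebra.mk' k Hᵐᵒᵖ
    (by
      change counit (R := k) (1 : H) = 1
      exact Bialgebra.counit_one)
    (fun {a b} => by
      change counit (R := k) (b.unop * a.unop) = counit a.unop * counit b.unop
      rw [Bialgebra.counit_mul, mul_comm])
    (by
      change TensorProduct.map _ _ (comul (R := k) (1 : H)) = 1
      rw [Bialgebra.comul_one]
      rfl)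
    (fun {a b} => by
      change TensorProduct.map _ _ (comul (R := k) (b.unop * a.unop)) =
        TensorProduct.map _ _ (comul a.unop) * TensorProduct.map _ _ (comul b.unop)
      rw [Bialgebra.comul_mul]
      generalize comul (R := k) a.unop = x
      generalize comul (R := k) b.unop = y
      induction x using TensorProduct.induction_on with
      | zero => simp
      | add x₁ x₂ h₁ h₂ => rw [mul_add, map_add, map_add, add_mul, h₁, h₂]
      | tmul a b =>
        induction y using TensorProduct.induction_on with
        | zero => simp
        | add y₁ y₂ h₁ h₂ => rw [add_mul, map_add, map_add, mul_add, h₁, h₂]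
        | tmul c d => simp)

variable (hS : Function.Bijective (antipode k : H →ₗ[k] H))

/-- Companion of `mul_antipodeInv_comul`; the two are the antipode axioms for S⁻¹ on the opposite
algebra. -/
lemma mul_antipodeInv_rTensor_comul (x : H) : LinearMap.mul' k H (TensorProduct.comm k H H
    ((antipodeInv hS).rTensor H (comul (R := k) x))) = algebraMap k H (counit x) := by
  apply hS.1
  have h1 : ∀ z : H ⊗[k] H, antipode k (LinearMap.mul' k H (TensorProduct.comm k H H
      ((antipodeInv hS).rTensor H z))) = LinearMap.mul' k H ((antipode k).lTensor H z) := by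
    intro z
    induction z using TensorProduct.induction_on with
    | zero => simp
    | add x y hx hy => simp only [map_add, hx, hy]
    | tmul x y => simp [antipode_mul_antidistrib, antipode_antipodeInv]
  rw [h1, mul_antipode_lTensor_comul_apply, Algebra.algebraMap_eq_smul_one, map_smul, antipode_one]

/-- The opposite of a Hopf algebra with bijective antipode is a Hopf algebra. -/
@[reducible]
noncomputable def opHopfAlgebra : HopfAlgebra k Hᵐᵒᵖ where
  __ := opBialgebra k H
  antipode := (MulOpposite.opLinearEquiv k).toLinearMap ∘ₗ antipodeInv hS ∘ₗ
    (MulOpposite.opLinearEquiv k).symm.toLinearMap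
  mul_antipode_rTensor_comul := by
    ext x
    change LinearMap.mul' k Hᵐᵒᵖ (LinearMap.rTensor Hᵐᵒᵖ _ (TensorProduct.map _ _
      (comul x.unop))) = MulOpposite.op (algebraMap k H (counit x.unop))
    rw [← mul_antipodeInv_rTensor_comul hS]
    generalize comul (R := k) x.unop = z
    induction z using TensorProduct.induction_on with
    | zero => simp
    | add x y hx hy => simp only [map_add, MulOpposite.op_add, hx, hy]
    | tmul x y => simp
  mul_antipode_lTensor_comul := by
    ext x
    change LinearMap.mul' k Hᵐᵒᵖ (LinearMap.lTensor Hᵐᵒᵖ _ (TensorProduct.map _ _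
      (comul x.unop))) = MulOpposite.op (algebraMap k H (counit x.unop))
    rw [← mul_antipodeInv_comul hS]
    generalize comul (R := k) x.unop = z
    induction z using TensorProduct.induction_on with
    | zero => simp
    | add x y hx hy => simp only [map_add, MulOpposite.op_add, hx, hy]
    | tmul x y => simp

end OppositeHopf

section Correspondence

variable {k : Type u} {H : Type v} [Field k] [Ring H] [HopfAlgebra k H]

lemma toFactor_mem_leftEmbeddingFactors {A : Subalgebra k H} (hA : A ∈ leftFlatDominions k H) :
    toFactor A ∈ leftEmbeddingFactors k H := by
  have h := isCoideal_toFactor hA.1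
  exact ⟨h, (hasLocalSections_of_isLeftFlat hA.1 hA.2.2).leftComodulesEmbed⟩

lemma toFactor_coinvariants_of_mem {I : Ideal H} (hI : I ∈ leftEmbeddingFactors k H) :
    toFactor (coinvariants (k := k) I) = I := by
  obtain ⟨h, hI⟩ := hI
  exact toFactor_coinvariants hI.hasLocalSections

lemma coinvariants_mem_leftFlatDominions (hS : Function.Bijective (antipode k : H →ₗ[k] H))
    {I : Ideal H} (hI : I ∈ leftEmbeddingFactors k H) :
    coinvariants (k := k) I ∈ leftFlatDominions k H := by
  refine ⟨isRightCoideal_coinvariants I, ?_, ?_⟩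
  · rw [isDominion_iff (isRightCoideal_coinvariants I), toFactor_coinvariants_of_mem hI]
  · obtain ⟨h, hI⟩ := hI
    exact isLeftFlat_coinvariants hS hI.hasLocalSections

theorem bijOn_toFactor_left (hS : Function.Bijective (antipode k : H →ₗ[k] H)) :
    Set.BijOn toFactor (leftFlatDominions k H) (leftEmbeddingFactors k H) :=
  ⟨fun _ hA => toFactor_mem_leftEmbeddingFactors hA,
    -- Injectivity needs no flatness: on dominions the invariants are a left inverse.
    Set.LeftInvOn.injOn (f₁' := coinvariants) fun _ hA => (isDominion_iff hA.1).mp hA.2.1,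
    fun I hI => ⟨coinvariants I, coinvariants_mem_leftFlatDominions hS hI,
      toFactor_coinvariants_of_mem hI⟩⟩

lemma exists_oppositeEquiv (hS : Function.Bijective (antipode k : H →ₗ[k] H)) :
    ∃ (H' : Type v) (_ : Ring H') (_ : HopfAlgebra k H') (e : H ≃ₗ[k] H'),
      IsOppositeEquiv e ∧ Function.Bijective (antipode k : H' →ₗ[k] H') ∧
        ∀ x, antipode k (e (antipode k x)) = e x := by
  let := opHopfAlgebra hS
  refine ⟨Hᵐᵒᵖ, inferInstance, opHopfAlgebra hS, MulOpposite.opLinearEquiv k, ⟨fun x y => rfl,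
    fun x => rfl, fun x => rfl⟩, ?_, fun x => ?_⟩
  · exact (MulOpposite.opLinearEquiv k).bijective.comp
      ((LinearEquiv.ofBijective _ hS).symm.bijective.comp
        (MulOpposite.opLinearEquiv k).symm.bijective)
  · exact congrArg MulOpposite.op (antipodeInv_antipode hS x)

/-- Only `toFactor` has to be transported to the opposite algebra; the inverse assignment is then
determined by `isDominion_iff` in H itself. -/
theorem bijOn_toFactor_right (hS : Function.Bijective (antipode k : H →ₗ[k] H)) :
    Set.BijOn toFactor (rightFlatDominions k H) (rightEmbeddingFactors k H) := by
  obtain ⟨H', _, _, e, he, hS', hSe⟩ := exists_oppositeEquiv hS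
  have hs := he.isAntiCoalgHom_antipodeEquiv hS
  refine ⟨fun A hA => ?_,
    Set.LeftInvOn.injOn (f₁' := coinvariants) fun _ hA => (isDominion_iff hA.1).mp hA.2.1,
    fun I hI => ?_⟩
  · rw [← comap_symm_mem_leftEmbeddingFactors_iff hs, ← he.toFactor_subalgebra hS hS' hSe hA.1]
    exact toFactor_mem_leftEmbeddingFactors (he.subalgebra_mem_leftFlatDominions_iff.mpr hA)
  · obtain ⟨B, hB, hBI⟩ := (bijOn_toFactor_left hS').surjOn
      ((comap_symm_mem_leftEmbeddingFactors_iff hs).mpr hI)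
    obtain ⟨A, rfl⟩ : ∃ A, he.subalgebra A = B :=
      ⟨he.symm.subalgebra B, he.symm.symm_subalgebra_subalgebra B⟩
    have hA := he.subalgebra_mem_leftFlatDominions_iff.mp hB
    refine ⟨A, hA, ?_⟩
    rw [he.toFactor_subalgebra hS hS' hSe hA.1] at hBI
    exact Ideal.comap_injective_of_surjective _ (he.antipodeEquiv hS).symm.surjective hBI

lemma invOn_of_bijOn {s : Set (Subalgebra k H)} {t : Set (Ideal H)}
    (h : Set.BijOn toFactor s t) (hs : ∀ A ∈ s, IsRightCoideal A ∧ IsDominion A) :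
    Set.BijOn toFactor s t ∧ Set.BijOn coinvariants t s ∧ Set.InvOn coinvariants toFactor s t := by
  have h1 : Set.LeftInvOn coinvariants toFactor s := fun A hA =>
    (isDominion_iff (hs A hA).1).mp (hs A hA).2
  have h2 : Set.InvOn coinvariants toFactor s t := ⟨h1, h1.rightInvOn_image.mono h.surjOn⟩
  exact ⟨h, Set.BijOn.symm h2.symm h, h2⟩

end Correspondence

end Takeuchi

theorem theorem4p6 {k : Type*} {H : Type*} [Field k] [Ring H] [HopfAlgebra k H]
    (hS : Function.Bijective (HopfAlgebra.antipode k : H →ₗ[k] H)) :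
    (Set.BijOn Takeuchi.toFactor
        (Takeuchi.leftFlatDominions k H) (Takeuchi.leftEmbeddingFactors k H) ∧
      Set.BijOn Takeuchi.coinvariants
        (Takeuchi.leftEmbeddingFactors k H) (Takeuchi.leftFlatDominions k H) ∧
      Set.InvOn Takeuchi.coinvariants Takeuchi.toFactor
        (Takeuchi.leftFlatDominions k H) (Takeuchi.leftEmbeddingFactors k H)) ∧
    (Set.BijOn Takeuchi.toFactor
        (Takeuchi.rightFlatDominions k H) (Takeuchi.rightEmbeddingFactors k H) ∧
      Set.BijOn Takeuchi.coinvariants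
        (Takeuchi.rightEmbeddingFactors k H) (Takeuchi.rightFlatDominions k H) ∧
      Set.InvOn Takeuchi.coinvariants Takeuchi.toFactor
        (Takeuchi.rightFlatDominions k H) (Takeuchi.rightEmbeddingFactors k H)) :=
  ⟨Takeuchi.invOn_of_bijOn (Takeuchi.bijOn_toFactor_left hS) fun _ hA => ⟨hA.1, hA.2.1⟩,
    Takeuchi.invOn_of_bijOn (Takeuchi.bijOn_toFactor_right hS) fun _ hA => ⟨hA.1, hA.2.1⟩⟩
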